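/- **Theorem (Validity).** Consider $N\ge 3f+1$ nodes, of which all but at most $f$ are correct (let $H$ be the set of correct nodes); the others are Byzantine. Nodes communicate over an asynchronous authenticated network: messages between correct nodes are delivered after arbitrary finite delays, Byzantine nodes may send anything but cannot forge the sender. A correct node eventually takes every local step that stays enabled. *AVID-M.* In every epoch $e\ge 1$ there is one dispersal instance $\mathrm{VID}^e_j$ for each node $j$; servers accept chunks for it only from node $j$, and ignore repeated messages with the same sender and type. To disperse $B$, node $j$ encodes $B$ with an $(N-2f,N)$-erasure code, builds a Merkle tree with root $r$ over the $N$ chunks and sends each server its chunk with $r$ and a Merkle proof. A server that gets its chunk with a valid proof broadcasts $\mathtt{GotChunk}(r)$; it broadcasts $\mathtt{Ready}(r)$ on $N-f$ messages $\mathtt{GotChunk}(r)$ or $f+1$ messages $\mathtt{Ready}(r)$; on $2f+1$ messages $\mathtt{Ready}(r)$ it sets $\mathtt{ChunkRoot}=r$, and the instance has completed at this server. To retrieve, a client asks all servers for their chunks; a server answers once the instance has completed and the root of its own chunk is $\mathtt{ChunkRoot}$. On $N-2f$ chunks with valid proofs under one root $r$ the client decodes them to $B'$ and returns $B'$ if the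 Merkle root of the encoding of $B'$ is $r$, and an error string otherwise. No two distinct arguments that correct nodes hash within one instance, to disperse a block or to check a proof, have the same hash. *Binary agreement.* For each $e,j$ there is an instance $\mathrm{BA}^e_j$ of a binary agreement protocol with at most one output per node: (Termination) if all correct nodes input, every correct node eventually gets an output; (Agreement) if a correct node gets output $b$, every correct node eventually gets output $b$; (Validity) if a correct node gets output $b$, some correct node has input $b$. *DispersedLedger with inter-node linking.* A correct node $i$ starts the epochs $1,2,3,\dots$ in order. On starting epoch $e$, it lets $V^e_i[j]$, for each $j$, be the largest $t$ such that $\mathrm{VID}^1_j,\dots,\mathrm{VID}^t_j$ have completed at node $i$, and proposes the block $B^e_i=(T^e_i,V^e_i)$ with arbitrary transactions $T^e_i$ by dispersing it in $\mathrm{VID}^e_i$. It inputs $1$ to $\mathrm{BA}^e_j$ when $\mathrm{VID}^e_j$ has completed, unless it has already given an input; when $N-f$ instances $\mathrm{BA}^e_j$ have output $1$, it inputs $0$ to all $\mathrm{BA}^e_j$ without input. When all $\mathrm{BA}^e_j$ have output, it lets $S^e_i$ be the set of $j$ with output $1$, and may start epoch $e+1$. Concurrently, it goes through the retrieval phase of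 epoch $e$ (the phases deliver in the order of the epochs): it retrieves the blocks of $\mathrm{VID}^e_j$, $j\in S^e_i$, delivers them by increasing $j$, and marks them delivered; with ${V^e_j}'$ the observation array in the retrieved block ($[\infty,\dots,\infty]$ if the block is ill-formatted or the error string), it lets $E^e_i[j]$ be the $(f+1)$-th largest of the values ${V^e_k}'[j]$, $k\in S^e_i$, counted with multiplicity; then, for all $j$ and all $1\le d\le E^e_i[j]$ such that the block of node $j$ for epoch $d$ is not marked delivered, it marks this block, retrieves it, and delivers all these blocks by increasing epoch and node index (delivery by inter-node linking), which finishes the epoch. Then in every such run: 1. Every block $B^e_i$ proposed by a correct node $i$ in an epoch $e$ is eventually delivered, with exactly the proposed content, by every correct node $k$; if $\mathrm{BA}^e_i$ outputs $0$ at $k$ (so that the block is not chosen in its own epoch), then $k$ eventually delivers it by inter-node linking. 2. Whenever a correct node $k$ has computed $E^e_k$, for every node $j$ there are correct nodes $p,q$ with $V^e_p[j]\le E^e_k[j]\le V^e_q[j]$. -/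

import Mathlib

namespace DispersedLedger

noncomputable section

open scoped Classical

-- ---------------------------------------------------------------------------
-- Blocks
-- ---------------------------------------------------------------------------

/-- A block is a piece of data that either parses as transactions `T` together with an observation
array `V`, or is ill-formatted. -/
inductive Block (N : ℕ) (Tx : Type*) where
  | formatted (T : Tx) (V : Fin N → ℕ)
  | illFormatted (data : List Bool)

/-- What an invocation of `Retrieve` may return: a block or the error string. -/
inductive Retrieved (N : ℕ) (Tx : Type*) where
  | block (B : Block N Tx)
  | badUploader

/-- The observation extracted from a retrieved block: its array `V`, or `[∞, …, ∞]` if the block is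
ill-formatted or the error string was retrieved. -/
def Retrieved.observation {N : ℕ} {Tx : Type*} : Retrieved N Tx → Fin N → ℕ∞
  | .block (.formatted _ V) => fun j => (V j : ℕ∞)
  | .block (.illFormatted _) => fun _ => ⊤
  | .badUploader => fun _ => ⊤

-- ---------------------------------------------------------------------------
-- Erasure codes and Merkle trees
-- ---------------------------------------------------------------------------

/-- A `(K, N)`-erasure code: data is encoded into `N` chunks, and any `K` of them determine the data
(an array with `none` at an index is an array with that chunk missing). -/
structure ErasureCode (K N : ℕ) (Data Chunk : Type*) where
  encode : Data → Fin N → Chunk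
  decode : (Fin N → Option Chunk) → Data
  decode_encode : ∀ (B : Data) (D : Finset (Fin N)), D.card = K →
    decode (fun i => if i ∈ D then some (encode B i) else none) = B

/-- The arguments to which the hash function is applied: a leaf of a Merkle tree (`none` for a leaf
that pads the tree to a power of two), or the digests of two children. -/
inductive HashInput (Chunk Digest : Type*) where
  | leaf (c : Option Chunk)
  | node (left right : Digest)

section Merkle

variable {Chunk Digest : Type*}

/-- The depth of a Merkle tree with `N` leaves. -/
def merkleDepth (N : ℕ) : ℕ := Nat.clog 2 N

/-- The leaves of the tree: the chunks, followed by padding. -/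
def merkleLeaf {N : ℕ} (C : Fin N → Chunk) (k : ℕ) : Option Chunk :=
  if h : k < N then some (C ⟨k, h⟩) else none

/-- The digest of the `k`-th node at height `l` of the Merkle tree over the chunks `C`. -/
def merkleNode {N : ℕ} (hash : HashInput Chunk Digest → Digest) (C : Fin N → Chunk) :
    ℕ → ℕ → Digest
  | 0, k => hash (.leaf (merkleLeaf C k))
  | l + 1, k => hash (.node (merkleNode hash C l (2 * k)) (merkleNode hash C l (2 * k + 1)))

/-- The Merkle root of an array of chunks. -/
def merkleRoot {N : ℕ} (hash : HashInput Chunk Digest → Digest) (C : Fin N → Chunk) : Digest :=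
  merkleNode hash C (merkleDepth N) 0

/-- The Merkle proof for the `i`-th chunk: the siblings of the nodes on the path from the `i`-th
leaf to the root, from bottom to top. -/
def merkleProof {N : ℕ} (hash : HashInput Chunk Digest → Digest) (C : Fin N → Chunk)
    (i : Fin N) : List Digest :=
  (List.range (merkleDepth N)).map fun l =>
    merkleNode hash C l
      (if (i : ℕ) / 2 ^ l % 2 = 0 then (i : ℕ) / 2 ^ l + 1 else (i : ℕ) / 2 ^ l - 1)

/-- The hash argument formed from the `k`-th node of a level, with digest `x`, and its sibling. -/
def joinSibling (k : ℕ) (x sibling : Digest) : HashInput Chunk Digest :=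
  if k % 2 = 0 then .node x sibling else .node sibling x

/-- Recomputes the root from the `k`-th node of a level, with digest `x`, and the siblings above. -/
def climb (hash : HashInput Chunk Digest → Digest) : ℕ → Digest → List Digest → Digest
  | _, x, [] => x
  | k, x, y :: ys => climb hash (k / 2) (hash (joinSibling k x y)) ys

/-- The arguments hashed by `climb`. -/
def climbInputs (hash : HashInput Chunk Digest → Digest) :
    ℕ → Digest → List Digest → Set (HashInput Chunk Digest)
  | _, _, [] => ∅
  | k, x, y :: ys => insert (joinSibling k x y)
      (climbInputs hash (k / 2) (hash (joinSibling k x y)) ys)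

/-- The proof `p` shows that `c` is the `i`-th of `N` chunks under the root `r`. -/
def ValidProof {N : ℕ} (hash : HashInput Chunk Digest → Digest) (i : Fin N) (r : Digest)
    (c : Chunk) (p : List Digest) : Prop :=
  p.length = merkleDepth N ∧ climb hash i (hash (.leaf (some c))) p = r

/-- The arguments hashed when a proof for the `i`-th of `N` chunks is checked. -/
def proofInputs {N : ℕ} (hash : HashInput Chunk Digest → Digest) (i : Fin N)
    (c : Chunk) (p : List Digest) : Set (HashInput Chunk Digest) :=
  {x | p.length = merkleDepth N ∧
    (x = .leaf (some c) ∨ x ∈ climbInputs hash i (hash (.leaf (some c))) p)}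

/-- The arguments hashed when the Merkle tree over the chunks `C` is formed. -/
def treeInputs {N : ℕ} (hash : HashInput Chunk Digest → Digest) (C : Fin N → Chunk) :
    Set (HashInput Chunk Digest) :=
  {x | (∃ k < 2 ^ merkleDepth N, x = .leaf (merkleLeaf C k)) ∨
    (∃ l < merkleDepth N, ∃ k < 2 ^ (merkleDepth N - (l + 1)),
      x = .node (merkleNode hash C l (2 * k)) (merkleNode hash C l (2 * k + 1)))}

end Merkle

-- ---------------------------------------------------------------------------
-- Messages and states
-- ---------------------------------------------------------------------------

/-- `(e, j)` names the VID instance of epoch `e` that is reserved for the `j`-th node. -/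
abbrev VidId (N : ℕ) := ℕ × Fin N

/-- A chunk together with a root and a proof. -/
structure ProvenChunk (Chunk Digest : Type*) where
  root : Digest
  chunk : Chunk
  proof : List Digest

/-- The messages of a VID instance. -/
inductive Msg (Chunk Digest : Type*) where
  | chunk (m : ProvenChunk Chunk Digest)
  | gotChunk (r : Digest)
  | ready (r : Digest)
  | requestChunk
  | returnChunk (m : ProvenChunk Chunk Digest)

/-- A message as it is emitted by a node: receiver, VID instance and content. -/
structure Outgoing (N : ℕ) (Chunk Digest : Type*) where
  dst : Fin N
  vid : VidId N
  msg : Msg Chunk Digest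

/-- A message in the network, tagged with its (authenticated) sender. -/
structure Packet (N : ℕ) (Chunk Digest : Type*) where
  src : Fin N
  out : Outgoing N Chunk Digest

/-- The state that a node keeps for one VID instance. -/
structure VidState (N : ℕ) (Tx Chunk Digest : Type*) where
  /-- server: the first `Chunk` message received from the owner of the instance -/
  chunkMsg : Option (ProvenChunk Chunk Digest) := none
  /-- server: the root in the first `GotChunk` message received from each server -/
  gotFrom : Fin N → Option Digest := fun _ => none
  /-- server: the root in the first `Ready` message received from each server -/
  readyFrom : Fin N → Option Digest := fun _ => none
  /-- server: `ChunkRoot`; the dispersal is `Complete` when it is set -/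
  chunkRoot : Option Digest := none
  /-- server: the clients whose `RequestChunk` is still to be answered -/
  requests : Set (Fin N) := ∅
  /-- client: `Retrieve` has been invoked -/
  retrieving : Prop := False
  /-- client: the first `ReturnChunk` message received from each server -/
  returned : Fin N → Option (ProvenChunk Chunk Digest) := fun _ => none
  /-- client: the value returned by `Retrieve` -/
  result : Option (Retrieved N Tx) := none

/-- An entry of the log of delivered blocks: the block of node `proposer` for epoch `epoch`, as
retrieved; `linked` records whether it was delivered through inter-node linking. -/
structure Delivery (N : ℕ) (Tx : Type*) where
  epoch : ℕ
  proposer : Fin N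
  content : Retrieved N Tx
  linked : Bool

/-- The state of a node. -/
structure NodeState (N : ℕ) (Tx Chunk Digest : Type*) where
  /-- the last epoch whose dispersal phase has been started (`0` if none) -/
  epoch : ℕ := 0
  /-- the transactions and the observation in the block proposed in each epoch -/
  proposed : ℕ → Option (Tx × (Fin N → ℕ)) := fun _ => none
  vid : VidId N → VidState N Tx Chunk Digest := fun _ => {}
  /-- the `Input` to, and the `Output` of, the `j`-th BA instance of epoch `e` -/
  baIn : ℕ → Fin N → Option Bool := fun _ _ => none
  baOut : ℕ → Fin N → Option Bool := fun _ _ => none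
  /-- the epochs whose retrieval phase has been started -/
  retrievalStarted : Set ℕ := ∅
  /-- all epochs up to this one are finished (their retrieval phase has ended) -/
  finished : ℕ := 0
  /-- the blocks being downloaded for inter-node linking in epoch `finished + 1`, if the retrieval
  phase of that epoch has come to this point -/
  linking : Option (Set (VidId N)) := none
  /-- the estimation `E` computed in each epoch -/
  estimation : ℕ → Option (Fin N → ℕ∞) := fun _ => none
  /-- the pairs `(d, j)` with `Delivered[d][j] = 1` -/
  delivered : Set (VidId N) := ∅
  /-- the blocks delivered so far, in order -/
  log : List (Delivery N Tx) := []

/-- The fixed ingredients of the protocol for `N` nodes, at most `f` of which are Byzantine. -/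
structure Protocol (N f : ℕ) (Tx Chunk Digest : Type*) where
  code : ErasureCode (N - 2 * f) N (Block N Tx) Chunk
  hash : HashInput Chunk Digest → Digest

section Node

variable {N f : ℕ} {Tx Chunk Digest : Type*} (P : Protocol N f Tx Chunk Digest)

/-- The same message to all servers, including the sender. -/
def broadcast (v : VidId N) (m : Msg Chunk Digest) : Set (Outgoing N Chunk Digest) :=
  {o | o.vid = v ∧ o.msg = m}

-- ---------------------------------------------------------------------------
-- AVID-M
-- ---------------------------------------------------------------------------

/-- The dispersal of a block by a client: the `k`-th server is sent the `k`-th chunk. -/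
def disperse (v : VidId N) (B : Block N Tx) : Set (Outgoing N Chunk Digest) :=
  {o | o.vid = v ∧ o.msg = .chunk ⟨merkleRoot P.hash (P.code.encode B), P.code.encode B o.dst,
    merkleProof P.hash (P.code.encode B) o.dst⟩}

/-- The chunk of the `i`-th server with its root and proof (`MyChunk`, `MyRoot`, `MyProof`), if it
is set. -/
def VidState.mine (i : Fin N) (s : VidState N Tx Chunk Digest) :
    Option (ProvenChunk Chunk Digest) :=
  s.chunkMsg.filter fun m => decide (ValidProof P.hash i m.root m.chunk m.proof)

/-- `ShareCount[r]`. -/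
def VidState.shareCount (s : VidState N Tx Chunk Digest) (r : Digest) : ℕ :=
  (Finset.univ.filter fun k => s.gotFrom k = some r).card

/-- `ReadyCount[r]`. -/
def VidState.readyCount (s : VidState N Tx Chunk Digest) (r : Digest) : ℕ :=
  (Finset.univ.filter fun k => s.readyFrom k = some r).card

/-- The chunks with root `r` and a valid proof that a retrieving client has collected. -/
def VidState.collected (s : VidState N Tx Chunk Digest) (r : Digest) (k : Fin N) :
    Option Chunk :=
  ((s.returned k).filter fun m =>
    decide (m.root = r ∧ ValidProof P.hash k m.root m.chunk m.proof)).map fun m => m.chunk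

/-- The end of `Retrieve`: decode, encode again, and compare the root with `r`. -/
def reconstruct (r : Digest) (D : Fin N → Option Chunk) : Retrieved N Tx :=
  if merkleRoot P.hash (P.code.encode (P.code.decode D)) = r then .block (P.code.decode D)
  else .badUploader

/-- The reaction of the `i`-th node, in VID instance `v`, to a message from the node `src`. Messages
that repeat sender and type are ignored, and so are `Chunk` messages that do not come from the
owner of the instance and `ReturnChunk` messages while `Retrieve` has not been invoked. -/
def VidState.receive (i : Fin N) (v : VidId N) (src : Fin N) (s : VidState N Tx Chunk Digest) :
    Msg Chunk Digest → VidState N Tx Chunk Digest × Set (Outgoing N Chunk Digest)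
  | .chunk m =>
      if src = v.2 ∧ s.chunkMsg = none then
        ({ s with chunkMsg := some m },
          if ValidProof P.hash i m.root m.chunk m.proof then broadcast v (.gotChunk m.root) else ∅)
      else (s, ∅)
  | .gotChunk r =>
      if s.gotFrom src = none then
        let s' := { s with gotFrom := Function.update s.gotFrom src (some r) }
        (s', if N - f ≤ s'.shareCount r then broadcast v (.ready r) else ∅)
      else (s, ∅)
  | .ready r =>
      if s.readyFrom src = none then
        let s' := { s with readyFrom := Function.update s.readyFrom src (some r) }
        ({ s' with chunkRoot := if 2 * f + 1 ≤ s'.readyCount r then some r else s.chunkRoot },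
          if f + 1 ≤ s'.readyCount r then broadcast v (.ready r) else ∅)
      else (s, ∅)
  | .requestChunk => ({ s with requests := insert src s.requests }, ∅)
  | .returnChunk m =>
      if s.retrieving ∧ s.returned src = none then
        let s' := { s with returned := Function.update s.returned src (some m) }
        ({ s' with
            result :=
              if s.result = none ∧
                  N - 2 * f ≤ (Finset.univ.filter fun k => s'.collected P m.root k ≠ none).card
              then some (reconstruct P m.root (s'.collected P m.root))
              else s.result }, ∅)
      else (s, ∅)

/-- Receipt of a message by the `i`-th node. -/
def NodeState.receive (i src : Fin N) (v : VidId N) (m : Msg Chunk Digest)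
    (s : NodeState N Tx Chunk Digest) :
    NodeState N Tx Chunk Digest × Set (Outgoing N Chunk Digest) :=
  ({ s with vid := Function.update s.vid v ((s.vid v).receive P i v src m).1 },
    ((s.vid v).receive P i v src m).2)

-- ---------------------------------------------------------------------------
-- DispersedLedger with inter-node linking
-- ---------------------------------------------------------------------------

/-- The VID instance `v` has `Complete`d at the node. -/
def NodeState.Complete (s : NodeState N Tx Chunk Digest) (v : VidId N) : Prop :=
  (s.vid v).chunkRoot ≠ none

/-- The local view `V[j]`: the largest `t` such that the VID instances of the `j`-th node for the
epochs `1, …, t` have all `Complete`d (only finitely many ever have at a given time). -/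
def NodeState.view (s : NodeState N Tx Chunk Digest) (j : Fin N) : ℕ :=
  sSup {t | ∀ d, 1 ≤ d → d ≤ t → s.Complete (d, j)}

/-- All BA instances of epoch `e` have `Output`. -/
def NodeState.AllOutput (s : NodeState N Tx Chunk Digest) (e : ℕ) : Prop :=
  ∀ j, s.baOut e j ≠ none

/-- The set `S` of epoch `e`: the indices of the BA instances that have `Output(1)`. -/
def NodeState.chosen (s : NodeState N Tx Chunk Digest) (e : ℕ) : Finset (Fin N) :=
  Finset.univ.filter fun j => s.baOut e j = some true

/-- The block downloaded from the VID instance `v` (only used when the download is finished). -/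
def NodeState.downloaded (s : NodeState N Tx Chunk Digest) (v : VidId N) : Retrieved N Tx :=
  ((s.vid v).result).getD .badUploader

/-- The `k`-th largest element (`1 ≤ k`), with multiplicity, of a finite multiset. -/
def kthLargest (k : ℕ) (M : Multiset ℕ∞) : ℕ∞ :=
  (M.sort (· ≥ ·)).getD (k - 1) 0

/-- The estimation `E[j]` of epoch `e`: the `(f+1)`-th largest of the values at `j` of the downloaded
observations. -/
def NodeState.estimate (f : ℕ) (s : NodeState N Tx Chunk Digest) (e : ℕ) (j : Fin N) : ℕ∞ :=
  kthLargest (f + 1) ((s.chosen e).val.map fun k => (s.downloaded (e, k)).observation j)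

/-- Invocation of `Retrieve` on all instances in `W` on which it has not been invoked before. -/
def NodeState.retrieve (W : Set (VidId N)) (s : NodeState N Tx Chunk Digest) :
    NodeState N Tx Chunk Digest × Set (Outgoing N Chunk Digest) :=
  ({ s with vid := fun v => { s.vid v with retrieving := (s.vid v).retrieving ∨ v ∈ W } },
    {o | o.vid ∈ W ∧ ¬ (s.vid o.vid).retrieving ∧ o.msg = .requestChunk})

/-- The log entry for the block of the VID instance `v`. -/
def NodeState.entry (s : NodeState N Tx Chunk Digest) (linked : Bool) (v : VidId N) :
    Delivery N Tx :=
  ⟨v.1, v.2, s.downloaded v, linked⟩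

/-- The elements of a finite set of VID instances, by increasing epoch number, then node index. -/
def sortInstances (W : Set (VidId N)) (hW : W.Finite) : List (VidId N) :=
  ((hW.toFinset.image (toLex : ℕ × Fin N → ℕ ×ₗ Fin N)).sort (· ≤ ·)).map ofLex

/-- The steps that a correct node takes on its own. -/
inductive LocalAction (N : ℕ) where
  /-- start the dispersal phase of the next epoch: observe, propose and disperse a block -/
  | startEpoch
  /-- `Input(1)` to a BA instance after `Complete` of the VID instance -/
  | inputOne (e : ℕ) (j : Fin N)
  /-- `Input(0)` to all remaining BA instances of epoch `e` -/
  | inputZero (e : ℕ)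
  /-- answer the `RequestChunk` of the `k`-th node -/
  | respond (v : VidId N) (k : Fin N)
  /-- enter the retrieval phase of epoch `e`: invoke `Retrieve` on the chosen instances -/
  | startRetrieval (e : ℕ)
  /-- in epoch `finished + 1`: deliver the chosen blocks, compute the estimation, and invoke
  `Retrieve` on the blocks up to the estimation that have not been delivered -/
  | deliverChosen
  /-- in epoch `finished + 1`: deliver these further blocks and finish the epoch -/
  | deliverLinked

/-- The condition under which the `i`-th node may, and then eventually has to, take a step. -/
def LocalAction.Enabled (i : Fin N) (s : NodeState N Tx Chunk Digest) : LocalAction N → Prop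
  | .startEpoch => s.epoch = 0 ∨ s.AllOutput s.epoch
  | .inputOne e j => 1 ≤ e ∧ e ≤ s.epoch ∧ s.Complete (e, j) ∧ s.baIn e j = none
  | .inputZero e => 1 ≤ e ∧ e ≤ s.epoch ∧ N - f ≤ (s.chosen e).card ∧ ∃ j, s.baIn e j = none
  | .respond v k => k ∈ (s.vid v).requests ∧
      ∃ m, (s.vid v).mine P i = some m ∧ (s.vid v).chunkRoot = some m.root
  | .startRetrieval e => 1 ≤ e ∧ e ≤ s.epoch ∧ s.AllOutput e ∧ e ∉ s.retrievalStarted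
  | .deliverChosen => s.linking = none ∧ s.finished + 1 ∈ s.retrievalStarted ∧
      ∀ j ∈ s.chosen (s.finished + 1), (s.vid (s.finished + 1, j)).result ≠ none
  | .deliverLinked => ∃ W, s.linking = some W ∧ W.Finite ∧ ∀ v ∈ W, (s.vid v).result ≠ none

/-- The effect of a step of the `i`-th node, which has the transactions `tx e` to propose in epoch
`e`. -/
def LocalAction.exec (i : Fin N) (tx : ℕ → Tx) (s : NodeState N Tx Chunk Digest) :
    LocalAction N → NodeState N Tx Chunk Digest × Set (Outgoing N Chunk Digest)
  | .startEpoch =>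
      let e := s.epoch + 1
      ({ s with epoch := e, proposed := Function.update s.proposed e (some (tx e, s.view)) },
        disperse P (e, i) (.formatted (tx e) s.view))
  | .inputOne e j =>
      ({ s with baIn := Function.update s.baIn e (Function.update (s.baIn e) j (some true)) }, ∅)
  | .inputZero e =>
      ({ s with
          baIn := Function.update s.baIn e
            (fun j => if s.baIn e j = none then some false else s.baIn e j) }, ∅)
  | .respond v k =>
      ({ s with
          vid := Function.update s.vid v
            { s.vid v with requests := (s.vid v).requests \ {k} } },
        {o | o.dst = k ∧ o.vid = v ∧ ∃ m, (s.vid v).mine P i = some m ∧ o.msg = .returnChunk m})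
  | .startRetrieval e =>
      { s with retrievalStarted := insert e s.retrievalStarted }.retrieve
        {v | v.1 = e ∧ v.2 ∈ s.chosen e}
  | .deliverChosen =>
      let e := s.finished + 1
      let delivered := s.delivered ∪ {v | v.1 = e ∧ v.2 ∈ s.chosen e}
      let E := s.estimate f e
      let W : Set (VidId N) := {v | 1 ≤ v.1 ∧ (v.1 : ℕ∞) ≤ E v.2 ∧ v ∉ delivered}
      { s with
          log := s.log ++ ((s.chosen e).sort (· ≤ ·)).map fun j => s.entry false (e, j)
          estimation := Function.update s.estimation e (some E)
          delivered := delivered ∪ W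
          linking := some W }.retrieve W
  | .deliverLinked =>
      ({ s with
          log := s.log ++
            match s.linking with
            | none => []
            | some W => if hW : W.Finite then (sortInstances W hW).map (s.entry true) else []
          linking := none
          finished := s.finished + 1 }, ∅)

end Node

-- ---------------------------------------------------------------------------
-- Runs in the asynchronous network
-- ---------------------------------------------------------------------------

/-- A configuration: the states of the nodes (only those of correct nodes matter), and all messages
sent so far. -/
structure Config (N : ℕ) (Tx Chunk Digest : Type*) where
  node : Fin N → NodeState N Tx Chunk Digest := fun _ => {}
  net : Set (Packet N Chunk Digest) := ∅

/-- The events of a run. -/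
inductive Action (N : ℕ) (Chunk Digest : Type*) where
  | idle
  /-- a correct node takes a step -/
  | step (i : Fin N) (a : LocalAction N)
  /-- a message is delivered to a correct node -/
  | receive (p : Packet N Chunk Digest)
  /-- the `j`-th BA instance of epoch `e` gives `Output(b)` at a correct node -/
  | baOutput (i : Fin N) (e : ℕ) (j : Fin N) (b : Bool)
  /-- a Byzantine node sends a message -/
  | byzantine (p : Packet N Chunk Digest)

section Runs

variable {N f : ℕ} {Tx Chunk Digest : Type*} (P : Protocol N f Tx Chunk Digest)
  (H : Finset (Fin N)) (txs : Fin N → ℕ → Tx)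

/-- The `i`-th node changes its state and emits messages. -/
def Config.update (c : Config N Tx Chunk Digest) (i : Fin N)
    (r : NodeState N Tx Chunk Digest × Set (Outgoing N Chunk Digest)) :
    Config N Tx Chunk Digest :=
  { node := Function.update c.node i r.1
    net := c.net ∪ {p | p.src = i ∧ p.out ∈ r.2} }

/-- The events that can occur when `H` is the set of correct nodes. -/
def Action.Enabled (c : Config N Tx Chunk Digest) : Action N Chunk Digest → Prop
  | .idle => True
  | .step i a => i ∈ H ∧ a.Enabled P i (c.node i)
  | .receive p => p.out.dst ∈ H ∧ p ∈ c.net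
  | .baOutput i e j _ => i ∈ H ∧ (c.node i).baOut e j = none
  | .byzantine p => p.src ∉ H

/-- The effect of an event. -/
def Action.exec (c : Config N Tx Chunk Digest) :
    Action N Chunk Digest → Config N Tx Chunk Digest
  | .idle => c
  | .step i a => c.update i (a.exec P i (txs i) (c.node i))
  | .receive p => c.update p.out.dst
      ((c.node p.out.dst).receive P p.out.dst p.src p.out.vid p.out.msg)
  | .baOutput i e j b => c.update i
      ({ c.node i with
          baOut := Function.update (c.node i).baOut e
            (Function.update ((c.node i).baOut e) j (some b)) }, ∅)
  | .byzantine p => { c with net := insert p c.net }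

/-- A run of the protocol with the set `H` of correct nodes, where the `i`-th node has the
transactions `txs i e` to propose in epoch `e`. -/
structure Run where
  config : ℕ → Config N Tx Chunk Digest
  action : ℕ → Action N Chunk Digest
  init : config 0 = {}
  enabled : ∀ t, (action t).Enabled P H (config t)
  next : ∀ t, config (t + 1) = (action t).exec P txs (config t)

/-- Asynchrony: messages between correct nodes are delivered, and correct nodes take the steps that
stay enabled, after finite but unbounded delays. -/
structure Run.Fair {P : Protocol N f Tx Chunk Digest} {H : Finset (Fin N)}
    {txs : Fin N → ℕ → Tx} (R : Run P H txs) : Prop where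
  delivery : ∀ t, ∀ p ∈ (R.config t).net, p.src ∈ H → p.out.dst ∈ H →
    ∃ t', R.action t' = .receive p
  progress : ∀ i ∈ H, ∀ a : LocalAction N, ∀ t, a.Enabled P i ((R.config t).node i) →
    ∃ t' ≥ t, R.action t' = .step i a ∨ ¬ a.Enabled P i ((R.config t').node i)

/-- The specification of Binary Agreement, for the inputs and outputs that the nodes have given and
got up to each time. -/
structure IsBinaryAgreement (H : Finset (Fin N)) (input output : ℕ → Fin N → Option Bool) :
    Prop where
  termination : (∀ i ∈ H, ∃ t, input t i ≠ none) → ∀ i ∈ H, ∃ t, output t i ≠ none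
  agreement : ∀ b, ∀ i ∈ H, (∃ t, output t i = some b) → ∀ k ∈ H, ∃ t, output t k = some b
  validity : ∀ b, ∀ i ∈ H, ∀ t, output t i = some b → ∃ k ∈ H, input t k = some b

/-- Every BA instance in the run meets the specification of Binary Agreement. -/
def Run.BinaryAgreement {P : Protocol N f Tx Chunk Digest} {H : Finset (Fin N)}
    {txs : Fin N → ℕ → Tx} (R : Run P H txs) : Prop :=
  ∀ (e : ℕ) (j : Fin N), IsBinaryAgreement H
    (fun t i => ((R.config t).node i).baIn e j) (fun t i => ((R.config t).node i).baOut e j)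

/-- The arguments that correct nodes hash in the VID instance `v` in order to disperse a block or to
check a proof. -/
def Run.hashed {P : Protocol N f Tx Chunk Digest} {H : Finset (Fin N)}
    {txs : Fin N → ℕ → Tx} (R : Run P H txs) (v : VidId N) : Set (HashInput Chunk Digest) :=
  {x | ∃ t, ∃ i ∈ H,
    (∃ T V, v.2 = i ∧ ((R.config t).node i).proposed v.1 = some (T, V) ∧
      x ∈ treeInputs P.hash (P.code.encode (.formatted T V))) ∨
    (∃ m, (((R.config t).node i).vid v).chunkMsg = some m ∧
      x ∈ proofInputs P.hash i m.chunk m.proof) ∨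
    (∃ m k, (((R.config t).node i).vid v).returned k = some m ∧
      x ∈ proofInputs P.hash k m.chunk m.proof)}

/-- Correct nodes do not come across a hash collision within any VID instance. -/
def Run.CollisionFree {P : Protocol N f Tx Chunk Digest} {H : Finset (Fin N)}
    {txs : Fin N → ℕ → Tx} (R : Run P H txs) : Prop :=
  ∀ v, Set.InjOn P.hash (R.hashed v)

/-- The `i`-th node proposes, in epoch `e`, the block with transactions `T` and observation `V`. -/
def Run.Proposes {P : Protocol N f Tx Chunk Digest} {H : Finset (Fin N)}
    {txs : Fin N → ℕ → Tx} (R : Run P H txs) (i : Fin N) (e : ℕ) (T : Tx) (V : Fin N → ℕ) : Prop :=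
  ∃ t, ((R.config t).node i).proposed e = some (T, V)

end Runs

end

end DispersedLedger

/-! A block of a correct node is never lost, because an epoch comes in which every correct node
reports its dispersal as complete, and the estimation of that epoch cannot fall below what all
correct nodes report.

One dispersal instance. A correct server sends `Ready(r)` only if, up to faulty announcements, `N -
f` servers hold a chunk under `r`; two such sets of correct holders do not fit into `H`, so only one
root becomes ready (`Run.ready_unique`). Of `2f + 1` `Ready` messages `f + 1` are from correct
servers, and these make every correct server ready, so completion spreads from one correct server to
all (`Run.Fair.eventually_complete`). At least `N - 2f` correct holders then answer each retrieval
by a correct client, which therefore ends (`Run.Fair.eventually_result`). The dispersal of a correct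
node completes everywhere (`Run.Fair.eventually_complete_of_proposes`). Among the `N - 2f > f`
chunks used for decoding, one comes from a correct server, which pins the root to that of the
correct disperser, and collision-free Merkle proofs pin the other chunks; so the retrieval returns
the proposed block (`Run.result_eq`).

The epochs. By the common-subset argument all agreement instances of an epoch give outputs, at least
`N - f` of them `1` (`Run.Fair.eventually_allOutput`, `Run.BinaryAgreement.card_chosen`). The
estimation is thus the `(f+1)`-th largest of at least `2f + 1` values, at most `f` of them faulty,
and lies between two correct ones (`exists_le_kthLargest_le`, `Run.estimation_bounds`). The upper
bound leaves finitely many blocks to link, all of them completed at a correct node, so every epoch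
finishes (`Run.Fair.exists_finished`). The lower bound is applied in an epoch that all correct nodes
start after the dispersals up to the block in question have completed at them
(`Run.Fair.exists_observed`): the estimation reaches the block, which is linked unless it was
delivered before. Correct nodes need not agree on estimations or on the blocks of faulty nodes. -/

namespace DispersedLedger
open scoped Classical

/-! ### Soundness and completeness of Merkle proofs. -/

section Merkle

variable {Chunk Digest : Type*} {N : ℕ} {hash : HashInput Chunk Digest → Digest}

theorem joinSibling_injective_left {k : ℕ} {x y a b : Digest}
    (h : (joinSibling k x y : HashInput Chunk Digest) = .node a b) :
    x = if k % 2 = 0 then a else b := by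
  unfold joinSibling at h
  split_ifs at h ⊢ <;> simp_all

/-- A digest from which the Merkle root can be recomputed is the digest of that node. -/
theorem eq_merkleNode_of_climb (C : Fin N → Chunk) {S : Set (HashInput Chunk Digest)}
    (hS : Set.InjOn hash S) (htree : treeInputs hash C ⊆ S) :
    ∀ (ys : List Digest) (l k : ℕ) (x : Digest), l + ys.length = merkleDepth N →
      k < 2 ^ ys.length → climbInputs hash k x ys ⊆ S →
      climb hash k x ys = merkleRoot hash C → x = merkleNode hash C l k := by
  intro ys
  induction ys with
  | nil =>
    intro l k x hl hk _ h
    simp only [List.length_nil, add_zero, pow_zero, Nat.lt_one_iff] at hl hk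
    subst hk
    simpa [climb, merkleRoot, hl] using h
  | cons y ys ih =>
    intro l k x hl hk hsub h
    simp only [List.length_cons] at hl hk
    simp only [climb] at h
    simp only [climbInputs, Set.insert_subset_iff] at hsub
    have hk2 : k / 2 < 2 ^ ys.length := by
      rw [pow_succ] at hk; omega
    have h1 := ih (l + 1) (k / 2) _ (by omega) hk2 hsub.2 h
    -- The bound on `k` places the parent inside the tree. Its argument is therefore hashed too, and
    -- injectivity on `S` descends one level from the digest identified by the induction hypothesis.
    have h2 : (HashInput.node (merkleNode hash C l (2 * (k / 2)))
        (merkleNode hash C l (2 * (k / 2) + 1)) : HashInput Chunk Digest) ∈ S := by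
      refine htree (Or.inr ⟨l, by omega, k / 2, ?_, rfl⟩)
      have : merkleDepth N - (l + 1) = ys.length := by omega
      rwa [this]
    have h3 := joinSibling_injective_left (hS hsub.1 h2 h1)
    rw [h3]
    split_ifs with hpar
    · congr 1; omega
    · congr 1; omega

theorem lt_two_pow_merkleDepth (i : Fin N) : (i : ℕ) < 2 ^ merkleDepth N :=
  i.2.trans_le (Nat.le_pow_clog (by norm_num) N)

/-- In the absence of collisions, a valid proof authenticates the chunk. -/
theorem ValidProof.chunk_eq {C : Fin N → Chunk} {S : Set (HashInput Chunk Digest)}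
    (hS : Set.InjOn hash S) (htree : treeInputs hash C ⊆ S) {i : Fin N} {c : Chunk}
    {p : List Digest} (hp : ValidProof hash i (merkleRoot hash C) c p)
    (hsub : proofInputs hash i c p ⊆ S) : c = C i := by
  have h1 := eq_merkleNode_of_climb C hS htree p 0 i (hash (.leaf (some c))) (by simp [hp.1])
    (by rw [hp.1]; exact lt_two_pow_merkleDepth i)
    (fun x hx => hsub ⟨hp.1, Or.inr hx⟩) hp.2
  have h2 := hS (hsub ⟨hp.1, Or.inl rfl⟩)
    (htree (Or.inl ⟨i, lt_two_pow_merkleDepth i, rfl⟩)) h1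
  simpa [merkleLeaf] using h2

/-- The starting height is arbitrary so that the induction on the number of siblings can pass to the
parent, whose index is halved. The case `l = 0` shows that honest proofs are accepted. -/
theorem climb_siblings (C : Fin N → Chunk) (i : ℕ) :
    ∀ n l : ℕ, climb hash (i / 2 ^ l) (merkleNode hash C l (i / 2 ^ l))
      ((List.range' l n).map fun l => merkleNode hash C l
        (if i / 2 ^ l % 2 = 0 then i / 2 ^ l + 1 else i / 2 ^ l - 1)) =
      merkleNode hash C (l + n) (i / 2 ^ (l + n)) := by
  intro n
  induction n with
  | zero => intro l; simp [climb]
  | succ n ih =>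
    intro l
    simp only [List.range'_succ, List.map_cons, climb]
    have h := ih (l + 1)
    rw [show l + (n + 1) = l + 1 + n by omega, ← h]
    have hd : i / 2 ^ (l + 1) = i / 2 ^ l / 2 := by rw [pow_succ, Nat.div_div_eq_div_mul]
    rw [hd]
    congr 1
    simp only [merkleNode, joinSibling]
    split_ifs with hpar
    · congr 3 <;> omega
    · congr 3 <;> omega

theorem validProof_merkleProof (C : Fin N → Chunk) (i : Fin N) :
    ValidProof hash i (merkleRoot hash C) (C i) (merkleProof hash C i) := by
  refine ⟨by simp [merkleProof], ?_⟩
  have h := climb_siblings (hash := hash) C i (merkleDepth N) 0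
  simp only [pow_zero, Nat.div_one, zero_add, merkleNode,
    Nat.div_eq_of_lt (lt_two_pow_merkleDepth i)] at h
  simpa [merkleProof, merkleRoot, merkleLeaf, List.range_eq_range'] using h

end Merkle

/-! ### Order statistics of a multiset. -/

section KthLargest

/-- In the decreasingly sorted list, the first `k` entries are at least the `k`-th, and the `M.card
- (k - 1)` entries from the `k`-th on are at most it. The second count is stated without
subtraction. -/
theorem kthLargest_mem_and_card {k : ℕ} {M : Multiset ℕ∞} (hk : 1 ≤ k)
    (hM : k ≤ M.card) :
    k ≤ (M.filter fun x => kthLargest k M ≤ x).card ∧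
      M.card + 1 ≤ k + (M.filter fun x => x ≤ kthLargest k M).card := by
  set L := M.sort (· ≥ ·) with hL
  have hLM : (L : Multiset ℕ∞) = M := Multiset.sort_eq _ _
  have hlen : L.length = M.card := by rw [← hLM]; simp
  have hlt : k - 1 < L.length := by omega
  have hx : kthLargest k M = L[k - 1] := by
    simp [kthLargest, ← hL, List.getD, hlt]
  have hsort : L.Pairwise (· ≥ ·) := Multiset.pairwise_sort _ _
  rw [hx]
  set x := L[k - 1] with hxdef
  rw [← hLM]
  simp only [Multiset.filter_coe, Multiset.coe_card]
  constructor
  · have h1 : (L.take k).filter (fun y => decide (x ≤ y)) = L.take k := by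
      rw [List.filter_eq_self]
      intro a ha
      obtain ⟨n, hn, rfl⟩ := List.getElem_of_mem ha
      simp only [List.length_take] at hn
      simp only [List.getElem_take, decide_eq_true_eq, hxdef]
      rcases Nat.lt_or_ge n (k - 1) with h | h
      · exact List.pairwise_iff_getElem.mp hsort _ _ _ _ h
      · have : n = k - 1 := by omega
        subst this; exact le_rfl
    have h2 := ((List.take_sublist k L).filter (fun y => decide (x ≤ y))).length_le
    rw [h1, List.length_take] at h2
    omega
  · have h1 : (L.drop (k - 1)).filter (fun y => decide (y ≤ x)) = L.drop (k - 1) := by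
      rw [List.filter_eq_self]
      intro a ha
      obtain ⟨n, hn, rfl⟩ := List.getElem_of_mem ha
      simp only [List.getElem_drop, decide_eq_true_eq, hxdef]
      rcases Nat.eq_zero_or_pos n with h | h
      · subst h; exact le_rfl
      · exact List.pairwise_iff_getElem.mp hsort _ _ _ _ (by omega)
    have h2 := ((List.drop_sublist (k - 1) L).filter (fun y => decide (y ≤ x))).length_le
    rw [h1, List.length_drop] at h2
    omega

end KthLargest

/-! ### Counting correct and faulty nodes. -/

section Counting

variable {N : ℕ} {H : Finset (Fin N)}

theorem exists_mem_of_card_compl_lt (A : Finset (Fin N)) (h : (Hᶜ).card < A.card) :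
    ∃ k ∈ H, k ∈ A := by
  by_contra! hc
  exact absurd (Finset.card_le_card fun k hk => Finset.mem_compl.2 fun hkH => hc k hkH hk)
    (not_le.2 h)

theorem card_le_inter_add_compl (A : Finset (Fin N)) :
    A.card ≤ (H ∩ A).card + (Hᶜ).card := by
  refine (Finset.card_le_card (t := (H ∩ A) ∪ Hᶜ) fun k hk => ?_).trans (Finset.card_union_le _ _)
  by_cases hkH : k ∈ H <;> simp [hk, hkH]

theorem card_add_card_compl_fin : H.card + (Hᶜ).card = N := by
  simp

end Counting

/-- The `(f+1)`-th largest of values of which at most `f` are not from `H` lies between two values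
from `H`. -/
theorem exists_le_kthLargest_le {N f : ℕ} {H A : Finset (Fin N)} (g : Fin N → ℕ∞)
    (hH : (Hᶜ).card ≤ f) (hA : 2 * f + 1 ≤ A.card) :
    ∃ p ∈ H, p ∈ A ∧ ∃ q ∈ H, q ∈ A ∧ g p ≤ kthLargest (f + 1) (A.val.map g) ∧
      kthLargest (f + 1) (A.val.map g) ≤ g q := by
  obtain ⟨h1, h2⟩ := kthLargest_mem_and_card (k := f + 1) (M := A.val.map g) (by omega)
    (by simp; omega)
  set x := kthLargest (f + 1) (A.val.map g)
  rw [Multiset.filter_map, Multiset.card_map] at h1 h2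
  rw [Multiset.card_map] at h2
  -- At least `f + 1` values are `≥ x`, more than there are faulty nodes.
  obtain ⟨q, hqH, hq⟩ := exists_mem_of_card_compl_lt (H := H) (A.filter fun k => x ≤ g k) (by
    have : (A.filter fun k => x ≤ g k).card = (Multiset.filter ((fun y => x ≤ y) ∘ g) A.val).card :=
      rfl
    omega)
  -- At least `A.card - f`, hence again `f + 1`, values are `≤ x`.
  obtain ⟨p, hpH, hp⟩ := exists_mem_of_card_compl_lt (H := H) (A.filter fun k => g k ≤ x) (by
    have : (A.filter fun k => g k ≤ x).card = (Multiset.filter ((fun y => y ≤ x) ∘ g) A.val).card :=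
      rfl
    have h3 : A.card = A.val.card := rfl
    omega)
  rw [Finset.mem_filter] at hp hq
  exact ⟨p, hpH, hp.1, q, hqH, hq.1, hp.2, hq.2⟩

/-! ### Local view of a run: one node, one dispersal instance. -/

section Steps

variable {N f : ℕ} {Tx Chunk Digest : Type*} {P : Protocol N f Tx Chunk Digest}
  {H : Finset (Fin N)} {txs : Fin N → ℕ → Tx}

/-- The state of the `i`-th node at time `t`. -/
abbrev Run.state (R : Run P H txs) (t : ℕ) (i : Fin N) : NodeState N Tx Chunk Digest :=
  (R.config t).node i

/-- By time `t`, the node `src` has sent the message `m` of the VID instance `v` to `dst`. -/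
def Run.Sent (R : Run P H txs) (t : ℕ) (src dst : Fin N) (v : VidId N)
    (m : Msg Chunk Digest) : Prop :=
  (⟨src, ⟨dst, v, m⟩⟩ : Packet N Chunk Digest) ∈ (R.config t).net

/-- What may happen to the state of the `i`-th node in one unit of time. -/
inductive Run.NodeStep (R : Run P H txs) (t : ℕ) (i : Fin N) : NodeState N Tx Chunk Digest → Prop
  | stay : R.NodeStep t i (R.state t i)
  | act (a : LocalAction N) : i ∈ H → R.action t = .step i a → a.Enabled P i (R.state t i) →
      R.NodeStep t i (a.exec P i (txs i) (R.state t i)).1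
  | receive (src : Fin N) (v : VidId N) (m : Msg Chunk Digest) :
      R.action t = .receive ⟨src, ⟨i, v, m⟩⟩ → R.Sent t src i v m →
      R.NodeStep t i ((R.state t i).receive P i src v m).1
  | output (e : ℕ) (j : Fin N) (b : Bool) : (R.state t i).baOut e j = none →
      R.NodeStep t i { R.state t i with
        baOut := Function.update (R.state t i).baOut e
          (Function.update ((R.state t i).baOut e) j (some b)) }

theorem Run.nodeStep (R : Run P H txs) (t : ℕ) (i : Fin N) :
    R.NodeStep t i (R.state (t + 1) i) := by
  have hen := R.enabled t
  have hnext := R.next t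
  unfold Run.state
  rw [hnext]
  rcases ha : R.action t with _ | ⟨i', a⟩ | p | ⟨i', e, j, b⟩ | p <;> rw [ha] at hen
  · exact .stay
  · by_cases h : i = i'
    · subst h
      simp only [Action.exec, Config.update, Function.update_self]
      exact .act a hen.1 ha hen.2
    · simp only [Action.exec, Config.update, Function.update_of_ne h]
      exact .stay
  · by_cases h : i = p.out.dst
    · subst h
      simp only [Action.exec, Config.update, Function.update_self]
      exact .receive p.src p.out.vid p.out.msg ha hen.2
    · simp only [Action.exec, Config.update, Function.update_of_ne h]
      exact .stay
  · by_cases h : i = i'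
    · subst h
      simp only [Action.exec, Config.update, Function.update_self]
      exact .output e j b hen.2
    · simp only [Action.exec, Config.update, Function.update_of_ne h]
      exact .stay
  · exact .stay

/-- What may happen in one unit of time to the state that the `i`-th node keeps for the VID instance
`v`, and what it may send. -/
inductive Run.VidStep (R : Run P H txs) (t : ℕ) (i : Fin N) (v : VidId N) :
    VidState N Tx Chunk Digest → Set (Outgoing N Chunk Digest) → Prop
  | stay : R.VidStep t i v ((R.state t i).vid v) ∅
  | receive (src : Fin N) (m : Msg Chunk Digest) : R.Sent t src i v m →
      R.VidStep t i v (((R.state t i).vid v).receive P i v src m).1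
        (((R.state t i).vid v).receive P i v src m).2
  | respond (k : Fin N) (m : ProvenChunk Chunk Digest) : k ∈ ((R.state t i).vid v).requests →
      ((R.state t i).vid v).mine P i = some m →
      ((R.state t i).vid v).chunkRoot = some m.root →
      R.VidStep t i v { (R.state t i).vid v with
          requests := ((R.state t i).vid v).requests \ {k} }
        {o | o.dst = k ∧ o.vid = v ∧ o.msg = .returnChunk m}
  | retrieve : ¬ ((R.state t i).vid v).retrieving →
      R.VidStep t i v { (R.state t i).vid v with retrieving := True }
        {o | o.vid = v ∧ o.msg = .requestChunk}
  | disperse (T : Tx) (V : Fin N → ℕ) : v.2 = i →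
      (R.state (t + 1) i).proposed v.1 = some (T, V) →
      R.VidStep t i v ((R.state t i).vid v) (disperse P v (.formatted T V))

theorem Run.vidStep_of_stay {R : Run P H txs} {t : ℕ} {i : Fin N} {v : VidId N}
    (h : (R.state (t + 1) i).vid v = (R.state t i).vid v)
    {em : Set (Outgoing N Chunk Digest)} (hem : ∀ o ∈ em, o.vid ≠ v)
    (hnet : ∀ o, ⟨i, o⟩ ∈ (R.config (t + 1)).net ↔ ⟨i, o⟩ ∈ (R.config t).net ∨ o ∈ em) :
    ∃ em, R.VidStep t i v ((R.state (t + 1) i).vid v) em ∧ ∀ dst m,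
      R.Sent (t + 1) i dst v m ↔ R.Sent t i dst v m ∨ ⟨dst, v, m⟩ ∈ em := by
  refine ⟨∅, h ▸ .stay, fun dst m => ?_⟩
  unfold Run.Sent
  rw [hnet]
  simp only [Set.mem_empty_iff_false, or_false, or_iff_left_iff_imp]
  exact fun ho => absurd rfl (hem _ ho)

theorem Run.vidStep_of_retrieve {R : Run P H txs} {t : ℕ} {i : Fin N} {v : VidId N}
    {W : Set (VidId N)} {s : NodeState N Tx Chunk Digest} (hs : s.vid = (R.state t i).vid)
    (h : R.state (t + 1) i = (s.retrieve W).1)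
    (hnet : ∀ o, ⟨i, o⟩ ∈ (R.config (t + 1)).net ↔
      ⟨i, o⟩ ∈ (R.config t).net ∨ o ∈ (s.retrieve W).2) :
    ∃ em, R.VidStep t i v ((R.state (t + 1) i).vid v) em ∧ ∀ dst m,
      R.Sent (t + 1) i dst v m ↔ R.Sent t i dst v m ∨ ⟨dst, v, m⟩ ∈ em := by
  by_cases hv : v ∈ W ∧ ¬ ((R.state t i).vid v).retrieving
  · have h1 : (R.state (t + 1) i).vid v = { (R.state t i).vid v with retrieving := True } := by
      rw [h]; simp [NodeState.retrieve, hs, hv.1]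
    refine ⟨_, by rw [h1]; exact .retrieve hv.2, fun dst m => ?_⟩
    unfold Run.Sent
    rw [hnet]
    simp [NodeState.retrieve, hs, hv.1, hv.2]
  · have h1 : (R.state (t + 1) i).vid v = (R.state t i).vid v := by
      rw [h]
      have : (((R.state t i).vid v).retrieving ∨ v ∈ W) = ((R.state t i).vid v).retrieving :=
        propext (by tauto)
      simp only [NodeState.retrieve, hs, this]
    refine ⟨∅, h1 ▸ .stay, fun dst m => ?_⟩
    unfold Run.Sent
    rw [hnet]
    simp only [NodeState.retrieve, hs, Set.mem_ofPred_eq, Set.mem_empty_iff_false]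
    tauto

theorem Run.net_of_update {R : Run P H txs} {t : ℕ} {i : Fin N}
    {r : NodeState N Tx Chunk Digest × Set (Outgoing N Chunk Digest)}
    (h : R.config (t + 1) = (R.config t).update i r) (o : Outgoing N Chunk Digest) :
    ⟨i, o⟩ ∈ (R.config (t + 1)).net ↔ ⟨i, o⟩ ∈ (R.config t).net ∨ o ∈ r.2 := by
  rw [h]; simp [Config.update]

/-- Seen from one instance, every event of the run is of one of five kinds. Correctness of `i`
matters: a Byzantine event puts packets into the network without any change of the sender's state.
-/
theorem Run.vidStep (R : Run P H txs) (t : ℕ) {i : Fin N} (hi : i ∈ H) (v : VidId N) :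
    ∃ em, R.VidStep t i v ((R.state (t + 1) i).vid v) em ∧ ∀ dst m,
      R.Sent (t + 1) i dst v m ↔ R.Sent t i dst v m ∨ ⟨dst, v, m⟩ ∈ em := by
  have hen := R.enabled t
  have hnext := R.next t
  have other : ∀ i' r, i ≠ i' → R.config (t + 1) = (R.config t).update i' r →
      ∃ em, R.VidStep t i v ((R.state (t + 1) i).vid v) em ∧ ∀ dst m,
        R.Sent (t + 1) i dst v m ↔ R.Sent t i dst v m ∨ ⟨dst, v, m⟩ ∈ em := by
    intro i' r hne h
    refine Run.vidStep_of_stay (em := ∅) ?_ (by simp) fun o => ?_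
    · unfold Run.state; rw [h]; simp [Config.update, hne]
    · rw [h]; simp [Config.update, hne]
  rcases ha : R.action t with _ | ⟨i', a⟩ | p | ⟨i', e, j, b⟩ | p <;> rw [ha] at hen hnext
  · exact Run.vidStep_of_stay (em := ∅) (by unfold Run.state; rw [hnext]; rfl) (by simp)
      (by rw [hnext]; simp [Action.exec])
  · by_cases h : i = i'
    swap
    · exact other _ _ h hnext
    subst h
    have hst : R.state (t + 1) i = (a.exec P i (txs i) (R.state t i)).1 := by
      unfold Run.state; rw [hnext]; simp [Action.exec, Config.update]
    have hnet := Run.net_of_update hnext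
    have hea := hen.2
    cases a with
    | startEpoch =>
      by_cases hv : v = ((R.state t i).epoch + 1, i)
      · refine ⟨disperse P v (.formatted (txs i v.1) (R.state t i).view), ?_, fun dst m => ?_⟩
        · have h1 : (R.state (t + 1) i).vid v = (R.state t i).vid v := by
            rw [hst]; simp [LocalAction.exec]
          rw [h1]
          refine .disperse _ _ (by rw [hv]) ?_
          rw [hst]; simp [LocalAction.exec, hv]
        · unfold Run.Sent
          rw [hnet]
          simp [LocalAction.exec, hv]
      · refine Run.vidStep_of_stay (by rw [hst]; simp [LocalAction.exec]) (fun o ho => ?_) hnet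
        rintro rfl
        exact hv ho.1
    | inputOne e j =>
      exact Run.vidStep_of_stay (by rw [hst]; simp [LocalAction.exec])
        (by simp [LocalAction.exec]) hnet
    | inputZero e =>
      exact Run.vidStep_of_stay (by rw [hst]; simp [LocalAction.exec])
        (by simp [LocalAction.exec]) hnet
    | respond v' k =>
      by_cases hv : v = v'
      · subst hv
        obtain ⟨hk, m, hm, hr⟩ := hea
        refine ⟨{o | o.dst = k ∧ o.vid = v ∧ o.msg = .returnChunk m}, ?_, fun dst m' => ?_⟩
        · have h1 : (R.state (t + 1) i).vid v = { (R.state t i).vid v with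
              requests := ((R.state t i).vid v).requests \ {k} } := by
            rw [hst]; simp [LocalAction.exec]
          rw [h1]
          exact .respond k m hk hm hr
        · unfold Run.Sent
          rw [hnet]
          simp [LocalAction.exec, hm]
      · refine Run.vidStep_of_stay (by rw [hst]; simp [LocalAction.exec, hv])
          (fun o ho => ?_) hnet
        rintro rfl
        exact hv ho.2.1
    | startRetrieval e =>
      exact Run.vidStep_of_retrieve
        (s := { R.state t i with retrievalStarted := insert e (R.state t i).retrievalStarted })
        (W := {v | v.1 = e ∧ v.2 ∈ (R.state t i).chosen e}) rfl hst hnet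
    | deliverChosen =>
      simp only [LocalAction.exec] at hst hnet
      refine Run.vidStep_of_retrieve ?_ hst hnet
      rfl
    | deliverLinked =>
      exact Run.vidStep_of_stay (by rw [hst]; simp [LocalAction.exec])
        (by simp [LocalAction.exec]) hnet
  · by_cases h : i = p.out.dst
    swap
    · exact other _ _ h hnext
    obtain ⟨src, ⟨dst, v', m⟩⟩ := p
    subst h
    have hnet := Run.net_of_update hnext
    have hst : R.state (t + 1) i = ((R.state t i).receive P i src v' m).1 := by
      unfold Run.state; rw [hnext]; simp [Action.exec, Config.update]
    by_cases hv : v = v'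
    · subst hv
      refine ⟨(((R.state t i).vid v).receive P i v src m).2, ?_, fun dst m' => ?_⟩
      · have h1 : (R.state (t + 1) i).vid v = (((R.state t i).vid v).receive P i v src m).1 := by
          rw [hst]; simp [NodeState.receive]
        rw [h1]
        exact .receive src m hen.2
      · unfold Run.Sent
        rw [hnet]
        simp [NodeState.receive]
    · refine Run.vidStep_of_stay (by rw [hst]; simp [NodeState.receive, hv]) (fun o ho => ?_) hnet
      simp only [NodeState.receive] at ho
      rintro rfl
      apply hv
      cases m <;> simp only [VidState.receive] at ho <;> (try split_ifs at ho) <;>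
        first | exact ho.1 | exact absurd ho (by simp)
  · by_cases h : i = i'
    swap
    · exact other _ _ h hnext
    subst h
    exact Run.vidStep_of_stay (by unfold Run.state; rw [hnext]; simp [Action.exec, Config.update])
      (by simp) (Run.net_of_update hnext)
  · refine Run.vidStep_of_stay (em := ∅) (by unfold Run.state; rw [hnext]; rfl) (by simp)
      fun o => ?_
    rw [hnext]
    simp only [Action.exec, Set.mem_insert_iff, Set.mem_empty_iff_false, or_false,
      or_iff_right_iff_imp]
    rintro rfl
    exact absurd hi hen

theorem Run.sent_succ {R : Run P H txs} {t : ℕ} {src dst : Fin N} {v : VidId N}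
    {m : Msg Chunk Digest} (h : R.Sent t src dst v m) : R.Sent (t + 1) src dst v m := by
  unfold Run.Sent at h ⊢
  rw [R.next t]
  cases R.action t <;> simp only [Action.exec, Config.update] <;>
    first | exact h | exact Or.inl h | exact Set.mem_insert_of_mem _ h

theorem monotone_of_succ {p : ℕ → Prop} (h : ∀ t, p t → p (t + 1)) {t t' : ℕ} (htt : t ≤ t')
    (ht : p t) : p t' :=
  Nat.le_induction ht (fun n _ hn => h n hn) t' htt

theorem Run.sent_mono {R : Run P H txs} {t t' : ℕ} (htt : t ≤ t') {src dst : Fin N} {v : VidId N}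
    {m : Msg Chunk Digest} (h : R.Sent t src dst v m) : R.Sent t' src dst v m :=
  monotone_of_succ (p := fun t => R.Sent t src dst v m) (fun _ => Run.sent_succ) htt h

theorem Run.state_zero (R : Run P H txs) (i : Fin N) : R.state 0 i = {} := by
  unfold Run.state; rw [R.init]

theorem Run.not_sent_zero (R : Run P H txs) (src dst : Fin N) (v : VidId N)
    (m : Msg Chunk Digest) : ¬ R.Sent 0 src dst v m := by
  unfold Run.Sent; rw [R.init]; simp

/-- An invariant of the state of one VID instance at a correct node. -/
theorem Run.vid_induction (R : Run P H txs) {i : Fin N} (hi : i ∈ H) (v : VidId N)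
    {Q : ℕ → VidState N Tx Chunk Digest → (Fin N → Msg Chunk Digest → Prop) → Prop}
    (zero : Q 0 {} fun _ _ => False)
    (succ : ∀ t s em, R.VidStep t i v s em →
      Q t ((R.state t i).vid v) (fun dst m => R.Sent t i dst v m) →
      Q (t + 1) s (fun dst m => R.Sent t i dst v m ∨ ⟨dst, v, m⟩ ∈ em)) (t : ℕ) :
    Q t ((R.state t i).vid v) (fun dst m => R.Sent t i dst v m) := by
  induction t with
  | zero =>
    have : (fun dst m => R.Sent 0 i dst v m) = fun _ _ => False := by
      ext; simp [R.not_sent_zero]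
    rw [this, R.state_zero]; exact zero
  | succ t ih =>
    obtain ⟨em, hs, hnet⟩ := R.vidStep t hi v
    have := succ t _ em hs ih
    convert this using 3 with dst m
    exact hnet _ _

end Steps

/-! ### Safety invariants of AVID-M: messages have causes. -/

section VidInvariants

variable {N f : ℕ} {Tx Chunk Digest : Type*} {P : Protocol N f Tx Chunk Digest}
  {H : Finset (Fin N)} {txs : Fin N → ℕ → Tx}

/-- The information in `s` is kept in `s'`. -/
structure VidState.Extends (s s' : VidState N Tx Chunk Digest) : Prop where
  chunkMsg : ∀ m, s.chunkMsg = some m → s'.chunkMsg = some m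
  gotFrom : ∀ k r, s.gotFrom k = some r → s'.gotFrom k = some r
  readyFrom : ∀ k r, s.readyFrom k = some r → s'.readyFrom k = some r
  returned : ∀ k m, s.returned k = some m → s'.returned k = some m
  result : ∀ x, s.result = some x → s'.result = some x
  -- A later quorum for another root would overwrite the value; that there is none needs quorum
  -- counting, so only presence is claimed here.
  chunkRoot : s.chunkRoot ≠ none → s'.chunkRoot ≠ none
  retrieving : s.retrieving → s'.retrieving

theorem VidState.Extends.refl (s : VidState N Tx Chunk Digest) : s.Extends s := by
  constructor <;> simp

theorem VidState.Extends.trans {s s' s'' : VidState N Tx Chunk Digest} (h : s.Extends s')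
    (h' : s'.Extends s'') : s.Extends s'' where
  chunkMsg m hm := h'.1 _ (h.1 m hm)
  gotFrom _ _ hr := h'.2 _ _ (h.2 _ _ hr)
  readyFrom _ _ hr := h'.3 _ _ (h.3 _ _ hr)
  returned _ _ hr := h'.4 _ _ (h.4 _ _ hr)
  result _ hr := h'.5 _ (h.5 _ hr)
  chunkRoot hr := h'.6 (h.6 hr)
  retrieving hr := h'.7 (h.7 hr)

theorem VidState.receive_extends (i : Fin N) (v : VidId N) (src : Fin N)
    (s : VidState N Tx Chunk Digest) (m : Msg Chunk Digest) :
    s.Extends (s.receive P i v src m).1 := by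
  cases m <;> simp only [VidState.receive] <;> (try split_ifs) <;> constructor <;>
    simp only [Function.update_apply] <;> grind

theorem Run.VidStep.extends {R : Run P H txs} {t : ℕ} {i : Fin N} {v : VidId N}
    {s : VidState N Tx Chunk Digest} {em : Set (Outgoing N Chunk Digest)}
    (h : R.VidStep t i v s em) : ((R.state t i).vid v).Extends s := by
  cases h with
  | stay => exact .refl _
  | receive src m _ => exact VidState.receive_extends i v src _ m
  | respond k m _ _ _ => constructor <;> simp
  | retrieve _ => constructor <;> simp
  | disperse T V _ _ => exact .refl _

theorem Run.vid_extends {R : Run P H txs} {i : Fin N} (hi : i ∈ H) (v : VidId N) {t t' : ℕ}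
    (htt : t ≤ t') : ((R.state t i).vid v).Extends ((R.state t' i).vid v) := by
  induction t', htt using Nat.le_induction with
  | base => exact .refl _
  | succ t' _ ih =>
    obtain ⟨em, h, _⟩ := R.vidStep t' hi v
    exact ih.trans h.extends

theorem VidState.mine_eq_some {i : Fin N} {s : VidState N Tx Chunk Digest}
    {m : ProvenChunk Chunk Digest} : s.mine P i = some m ↔
      s.chunkMsg = some m ∧ ValidProof P.hash i m.root m.chunk m.proof := by
  simp [VidState.mine, Option.filter_eq_some_iff]

theorem VidState.collected_eq_some {s : VidState N Tx Chunk Digest} {r : Digest} {k : Fin N}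
    {c : Chunk} : s.collected P r k = some c ↔ ∃ m, s.returned k = some m ∧ m.root = r ∧
      ValidProof P.hash k m.root m.chunk m.proof ∧ m.chunk = c := by
  simp [VidState.collected, Option.filter_eq_some_iff, and_assoc]

theorem VidState.Extends.mine {i : Fin N} {s s' : VidState N Tx Chunk Digest}
    {m : ProvenChunk Chunk Digest} (h : s.Extends s') (hm : s.mine P i = some m) :
    s'.mine P i = some m := by
  rw [VidState.mine_eq_some] at hm ⊢
  exact ⟨h.1 _ hm.1, hm.2⟩

theorem VidState.Extends.shareCount_le {s s' : VidState N Tx Chunk Digest} (h : s.Extends s')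
    (r : Digest) : s.shareCount r ≤ s'.shareCount r := by
  refine Finset.card_le_card fun k hk => ?_
  simp only [Finset.mem_filter, Finset.mem_univ, true_and] at hk ⊢
  exact h.2 _ _ hk

theorem VidState.Extends.readyCount_le {s s' : VidState N Tx Chunk Digest} (h : s.Extends s')
    (r : Digest) : s.readyCount r ≤ s'.readyCount r := by
  refine Finset.card_le_card fun k hk => ?_
  simp only [Finset.mem_filter, Finset.mem_univ, true_and] at hk ⊢
  exact h.3 _ _ hk

/-- Everything that is recorded as received has been sent. -/
structure Run.Recorded (R : Run P H txs) (t : ℕ) (i : Fin N) (v : VidId N)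
    (s : VidState N Tx Chunk Digest) : Prop where
  chunkMsg : ∀ m, s.chunkMsg = some m → R.Sent t v.2 i v (.chunk m)
  gotFrom : ∀ k r, s.gotFrom k = some r → R.Sent t k i v (.gotChunk r)
  readyFrom : ∀ k r, s.readyFrom k = some r → R.Sent t k i v (.ready r)
  returned : ∀ k m, s.returned k = some m → R.Sent t k i v (.returnChunk m)
  requests : ∀ k ∈ s.requests, R.Sent t k i v .requestChunk

theorem Run.Recorded.mono {R : Run P H txs} {t t' : ℕ} (htt : t ≤ t') {i : Fin N} {v : VidId N}
    {s : VidState N Tx Chunk Digest} (h : R.Recorded t i v s) : R.Recorded t' i v s :=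
  ⟨fun m hm => Run.sent_mono htt (h.1 m hm), fun k m hm => Run.sent_mono htt (h.2 k m hm),
    fun k m hm => Run.sent_mono htt (h.3 k m hm), fun k m hm => Run.sent_mono htt (h.4 k m hm),
    fun k hm => Run.sent_mono htt (h.5 k hm)⟩

/-- A packet must be in the network before the step that receives it, whence `t - 1`. This gain of
one time unit drives the induction in `Run.card_holders_of_ready`. At `t = 0` nothing is recorded,
so the truncated subtraction is harmless. -/
theorem Run.recorded_pred (R : Run P H txs) {i : Fin N} (hi : i ∈ H) (v : VidId N) (t : ℕ) :
    R.Recorded (t - 1) i v ((R.state t i).vid v) := by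
  refine R.vid_induction hi v (Q := fun t s _ => R.Recorded (t - 1) i v s) ?_ ?_ t
  · constructor <;> simp
  · intro t s em hstep ih
    replace ih : R.Recorded t i v _ := ih.mono t.pred_le
    simp only [Nat.add_sub_cancel]
    cases hstep with
    | stay => exact ih
    | receive src m hsent =>
      obtain ⟨h1, h2, h3, h4, h5⟩ := ih
      cases m <;> simp only [VidState.receive] <;> (try split_ifs) <;> constructor <;>
        simp only [Function.update_apply] <;> grind
    | respond k m _ _ _ => exact ⟨ih.1, ih.2, ih.3, ih.4, fun k hk => ih.5 k hk.1⟩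
    | retrieve _ => exact ⟨ih.1, ih.2, ih.3, ih.4, ih.5⟩
    | disperse T V _ _ => exact ih

theorem Run.recorded (R : Run P H txs) {i : Fin N} (hi : i ∈ H) (v : VidId N) (t : ℕ) :
    R.Recorded t i v ((R.state t i).vid v) :=
  (R.recorded_pred hi v t).mono t.pred_le

/-- The sent messages of a correct node are justified by its state. -/
structure Run.Justified (R : Run P H txs) (t : ℕ) (i : Fin N) (v : VidId N)
    (s : VidState N Tx Chunk Digest) (sent : Fin N → Msg Chunk Digest → Prop) : Prop where
  chunk : ∀ k m, sent k (.chunk m) → v.2 = i ∧ ∃ t' ≤ t, ∃ T V,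
    (R.state t' i).proposed v.1 = some (T, V) ∧
      (⟨k, v, .chunk m⟩ : Outgoing N Chunk Digest) ∈ disperse P v (.formatted T V)
  gotChunk : ∀ k r, sent k (.gotChunk r) → ∃ m, s.mine P i = some m ∧ m.root = r
  ready : ∀ k r, sent k (.ready r) → N - f ≤ s.shareCount r ∨ f + 1 ≤ s.readyCount r
  requestChunk : ∀ k, sent k .requestChunk → s.retrieving
  returnChunk : ∀ k m, sent k (.returnChunk m) → s.mine P i = some m ∧
    2 * f + 1 ≤ s.readyCount m.root ∧ R.Sent t k i v .requestChunk

/-- `chunkRoot` is set only when a quorum of `Ready` messages is recorded, and recorded messages are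
never dropped. -/
theorem Run.readyCount_of_chunkRoot (R : Run P H txs) {i : Fin N} (hi : i ∈ H) (v : VidId N) (t : ℕ)
    (r : Digest) (hr : ((R.state t i).vid v).chunkRoot = some r) :
    2 * f + 1 ≤ ((R.state t i).vid v).readyCount r := by
  revert r
  refine R.vid_induction hi v
    (Q := fun t s _ => ∀ r, s.chunkRoot = some r → 2 * f + 1 ≤ s.readyCount r) ?_ ?_ t
  · simp
  · intro t s em hstep ih
    cases hstep with
    | stay => exact ih
    | receive src m hsent =>
      intro r hr
      have hle := (VidState.receive_extends (P := P) i v src ((R.state t i).vid v) m).readyCount_le r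
      cases m with
      | ready r' =>
        simp only [VidState.receive] at hr hle ⊢
        split_ifs at hr hle ⊢ <;>
          first | exact (ih _ hr).trans hle | (cases hr; assumption)
      | _ =>
        refine (ih r ?_).trans hle
        rw [← hr]
        simp only [VidState.receive]
        try split_ifs <;> rfl
    | respond k m _ _ _ => exact ih
    | retrieve _ => exact ih
    | disperse T V _ _ => exact ih

/-- The justifications are monotone in the state, so old messages stay justified (`key`), and only
the messages emitted by the current step have to be checked. -/
theorem Run.justified (R : Run P H txs) {i : Fin N} (hi : i ∈ H) (v : VidId N) (t : ℕ) :
    R.Justified t i v ((R.state t i).vid v) (fun dst m => R.Sent t i dst v m) := by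
  have key : ∀ t s s' sent, s.Extends s' → R.Justified t i v s sent →
      R.Justified (t + 1) i v s' sent := fun t s s' sent hs h =>
    ⟨fun k m hm => ⟨(h.1 k m hm).1, (h.1 k m hm).2.imp fun t' ht' => ⟨ht'.1.trans t.le_succ, ht'.2⟩⟩,
      fun k r hr => (h.2 k r hr).imp fun m hm => ⟨hs.mine hm.1, hm.2⟩,
      fun k r hr => (h.3 k r hr).imp (fun hc => hc.trans (hs.shareCount_le r))
        (fun hc => hc.trans (hs.readyCount_le r)),
      fun k hk => hs.retrieving (h.4 k hk),
      fun k m hm => ⟨hs.mine (h.5 k m hm).1, (h.5 k m hm).2.1.trans (hs.readyCount_le _),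
        Run.sent_succ (h.5 k m hm).2.2⟩⟩
  refine R.vid_induction hi v (Q := fun t s sent => R.Justified t i v s sent) ?_ ?_ t
  · constructor <;> simp
  · intro t s em hstep ih
    obtain ⟨h1, h2, h3, h4, h5⟩ := key t _ _ _ hstep.extends ih
    have hreq := (R.recorded hi v t).requests
    suffices h : R.Justified (t + 1) i v s (fun dst m => ⟨dst, v, m⟩ ∈ em) from
      ⟨fun k m hm => hm.elim (h1 k m) (h.1 k m), fun k m hm => hm.elim (h2 k m) (h.2 k m),
        fun k m hm => hm.elim (h3 k m) (h.3 k m), fun k hm => hm.elim (h4 k) (h.4 k),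
        fun k m hm => hm.elim (h5 k m) (h.5 k m)⟩
    clear h1 h2 h3 h4 h5 ih
    cases hstep with
    | stay => constructor <;> simp
    | receive src m hsent =>
      cases m with
      | chunk m =>
        simp only [VidState.receive]
        split_ifs with h h'
        · constructor <;> simp [broadcast, VidState.mine_eq_some, h']
        · constructor <;> simp
        · constructor <;> simp
      | gotChunk r =>
        simp only [VidState.receive]
        split_ifs with h h'
        · constructor <;> simp [broadcast]
          exact fun _ => Or.inl (Nat.sub_le_iff_le_add.mp h')
        · constructor <;> simp
        · constructor <;> simp
      | ready r =>
        simp only [VidState.receive]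
        split_ifs with h h' h'' h''
        · constructor <;> simp [broadcast]
          exact fun _ => Or.inr h''
        · constructor <;> simp
        · constructor <;> simp [broadcast]
          exact fun _ => Or.inr h''
        · constructor <;> simp
        · constructor <;> simp
      | requestChunk => constructor <;> simp [VidState.receive]
      | returnChunk m =>
        simp only [VidState.receive]
        split_ifs <;> constructor <;> simp
    | respond k m hk hm hr =>
      constructor <;> simp
      exact ⟨hm, Run.readyCount_of_chunkRoot R hi v t _ hr, Run.sent_succ (hreq _ hk)⟩
    | retrieve _ => constructor <;> simp
    | disperse T V hv hp =>
      constructor <;> simp [disperse]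
      exact fun k => ⟨hv, t + 1, le_rfl, T, V, hp, rfl, rfl, rfl⟩

end VidInvariants

/-! ### The converse: causes have effects; the course of a retrieval. -/

section Reactive

variable {N f : ℕ} {Tx Chunk Digest : Type*} {P : Protocol N f Tx Chunk Digest}
  {H : Finset (Fin N)} {txs : Fin N → ℕ → Tx}

theorem card_filter_update_of_ne {g : Fin N → Option Digest} {k : Fin N} {r r' : Digest}
    (h : r' ≠ r) : (Finset.univ.filter fun j => Function.update g k (some r) j = some r').card ≤
      (Finset.univ.filter fun j => g j = some r').card := by
  refine Finset.card_le_card fun j hj => ?_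
  simp only [Finset.mem_filter, Finset.mem_univ, true_and, Function.update_apply] at hj ⊢
  split_ifs at hj
  · exact absurd (Option.some.inj hj).symm h
  · exact hj

/-- A correct node has reacted to what it has received. -/
structure VidState.Reactive (P : Protocol N f Tx Chunk Digest) (i : Fin N)
    (s : VidState N Tx Chunk Digest) (sent : Fin N → Msg Chunk Digest → Prop) : Prop where
  gotChunk : ∀ m, s.mine P i = some m → ∀ k, sent k (.gotChunk m.root)
  ready : ∀ r, N - f ≤ s.shareCount r ∨ f + 1 ≤ s.readyCount r → ∀ k, sent k (.ready r)
  complete : ∀ r, 2 * f + 1 ≤ s.readyCount r → s.chunkRoot ≠ none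
  request : s.retrieving → ∀ k, sent k .requestChunk

/-- The step that lifts a count to its threshold also emits the reaction, and a message for one root
raises no count of another. The bound on `N` enters only at time zero: the threshold `N - f` must
not be met by an empty count. -/
theorem Run.reactive (R : Run P H txs) (hN : 3 * f + 1 ≤ N) {i : Fin N} (hi : i ∈ H) (v : VidId N)
    (t : ℕ) :
    ((R.state t i).vid v).Reactive P i (fun dst m => R.Sent t i dst v m) := by
  refine R.vid_induction hi v (Q := fun _ s sent => s.Reactive P i sent) ?_ ?_ t
  · constructor <;> simp [VidState.mine, VidState.shareCount, VidState.readyCount]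
    omega
  · intro t s em hstep ih
    obtain ⟨h1, h2, h3, h4⟩ := ih
    cases hstep with
    | stay =>
      exact ⟨fun m hm k => Or.inl (h1 m hm k), fun r hr k => Or.inl (h2 r hr k), h3,
        fun h k => Or.inl (h4 h k)⟩
    | receive src m hsent =>
      cases m with
      | chunk m =>
        simp only [VidState.receive]
        split_ifs with h h'
        · refine ⟨fun m' hm k => Or.inr ?_, fun r hr k => Or.inl (h2 r hr k), h3,
            fun h k => Or.inl (h4 h k)⟩
          rw [VidState.mine_eq_some] at hm
          obtain rfl : m = m' := by simpa using hm.1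
          simp [broadcast]
        · refine ⟨fun m' hm k => ?_, fun r hr k => Or.inl (h2 r hr k), h3,
            fun h k => Or.inl (h4 h k)⟩
          rw [VidState.mine_eq_some] at hm
          obtain rfl : m = m' := by simpa using hm.1
          exact absurd hm.2 h'
        · exact ⟨fun m hm k => Or.inl (h1 m hm k), fun r hr k => Or.inl (h2 r hr k), h3,
            fun h k => Or.inl (h4 h k)⟩
      | gotChunk r =>
        simp only [VidState.receive]
        split_ifs with h h'
        · refine ⟨fun m hm k => Or.inl (h1 m hm k), fun r' hr k => ?_, h3,
            fun h k => Or.inl (h4 h k)⟩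
          by_cases hrr : r' = r
          · subst hrr; right; simp [broadcast]
          · exact Or.inl (h2 r' (hr.imp_left fun hr => hr.trans (card_filter_update_of_ne hrr)) k)
        · refine ⟨fun m hm k => Or.inl (h1 m hm k), fun r' hr k => ?_, h3,
            fun h k => Or.inl (h4 h k)⟩
          by_cases hrr : r' = r
          · subst hrr
            exact Or.inl (h2 r' (hr.imp_left fun hr => absurd hr h') k)
          · exact Or.inl (h2 r' (hr.imp_left fun hr => hr.trans (card_filter_update_of_ne hrr)) k)
        · exact ⟨fun m hm k => Or.inl (h1 m hm k), fun r hr k => Or.inl (h2 r hr k), h3,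
            fun h k => Or.inl (h4 h k)⟩
      | ready r =>
        simp only [VidState.receive]
        by_cases h : ((R.state t i).vid v).readyFrom src = none
        · rw [if_pos h]
          refine ⟨fun m hm k => Or.inl (h1 m hm k), fun r' hr k => ?_, fun r' hr => ?_,
            fun h k => Or.inl (h4 h k)⟩
          · by_cases hrr : r' = r
            · subst hrr
              rcases hr with hr | hr
              · exact Or.inl (h2 r' (Or.inl hr) k)
              · right
                simp only
                split_ifs with hc
                · simp [broadcast]
                · exact absurd hr hc
            · exact Or.inl
                (h2 r' (hr.imp_right fun hr => hr.trans (card_filter_update_of_ne hrr)) k)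
          · simp only
            split_ifs with h'
            · simp
            · by_cases hrr : r' = r
              · subst hrr; exact absurd hr h'
              · exact h3 r' (hr.trans (card_filter_update_of_ne hrr))
        · rw [if_neg h]
          exact ⟨fun m hm k => Or.inl (h1 m hm k), fun r hr k => Or.inl (h2 r hr k), h3,
            fun h k => Or.inl (h4 h k)⟩
      | requestChunk =>
        exact ⟨fun m hm k => Or.inl (h1 m hm k), fun r hr k => Or.inl (h2 r hr k), h3,
            fun h k => Or.inl (h4 h k)⟩
      | returnChunk m =>
        simp only [VidState.receive]
        split_ifs <;>
        exact ⟨fun m hm k => Or.inl (h1 m hm k), fun r hr k => Or.inl (h2 r hr k), h3,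
            fun h k => Or.inl (h4 h k)⟩
    | respond k m _ _ _ =>
      exact ⟨fun m hm k => Or.inl (h1 m hm k), fun r hr k => Or.inl (h2 r hr k), h3,
        fun h k => Or.inl (h4 h k)⟩
    | retrieve _ =>
      exact ⟨fun m hm k => Or.inl (h1 m hm k), fun r hr k => Or.inl (h2 r hr k), h3,
        fun h k => Or.inr (by simp)⟩
    | disperse T V _ _ =>
      exact ⟨fun m hm k => Or.inl (h1 m hm k), fun r hr k => Or.inl (h2 r hr k), h3,
        fun h k => Or.inl (h4 h k)⟩

/-- The number of chunks that have been collected under the root `r`. -/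
noncomputable def VidState.collectedCount (P : Protocol N f Tx Chunk Digest) (s : VidState N Tx Chunk Digest)
    (r : Digest) : ℕ :=
  (Finset.univ.filter fun k => s.collected P r k ≠ none).card

/-- The state of a retrieval: nothing is returned before enough chunks are collected under some
root, and then the outcome is computed from exactly as many chunks as the code needs. -/
structure VidState.RetrievalInv (P : Protocol N f Tx Chunk Digest)
    (s : VidState N Tx Chunk Digest) : Prop where
  count_lt : s.result = none → ∀ r, s.collectedCount P r < N - 2 * f
  result : ∀ x, s.result = some x → ∃ r C, x = reconstruct P r C ∧
    (Finset.univ.filter fun k => C k ≠ none).card = N - 2 * f ∧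
    ∀ k c, C k = some c → s.collected P r k = some c

theorem VidState.Extends.collected {s s' : VidState N Tx Chunk Digest} (h : s.Extends s')
    {r : Digest} {k : Fin N} {c : Chunk} (hc : s.collected P r k = some c) :
    s'.collected P r k = some c := by
  rw [VidState.collected_eq_some] at hc ⊢
  obtain ⟨m, hm, hc⟩ := hc
  exact ⟨m, h.returned _ _ hm, hc⟩

/-- Only the entry of `src` can be new. As the count was below `N - 2 * f` before, decoding takes
place with exactly that many chunks, as `ErasureCode.decode_encode` requires. -/
theorem VidState.collectedCount_le_succ {s s' : VidState N Tx Chunk Digest} {src : Fin N}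
    (h : ∀ k, k ≠ src → s'.returned k = s.returned k) (r : Digest) :
    s'.collectedCount P r ≤ s.collectedCount P r + 1 := by
  refine (Finset.card_le_card (t := insert src
    (Finset.univ.filter fun k => s.collected P r k ≠ none)) fun k hk => ?_).trans
    (Finset.card_insert_le _ _)
  simp only [Finset.mem_filter, Finset.mem_univ, true_and, Finset.mem_insert] at hk ⊢
  by_cases hks : k = src
  · exact Or.inl hks
  · right
    unfold VidState.collected at hk ⊢
    rwa [h k hks] at hk

theorem VidState.collectedCount_le_of_ne {s s' : VidState N Tx Chunk Digest} {src : Fin N}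
    {m : ProvenChunk Chunk Digest}
    (h : s'.returned = Function.update s.returned src (some m)) {r : Digest} (hr : r ≠ m.root) :
    s'.collectedCount P r ≤ s.collectedCount P r := by
  refine Finset.card_le_card fun k hk => ?_
  simp only [Finset.mem_filter, Finset.mem_univ, true_and, Option.ne_none_iff_exists',
    VidState.collected_eq_some] at hk ⊢
  obtain ⟨c, m', hm', hmr, hv⟩ := hk
  rw [h, Function.update_apply] at hm'
  split_ifs at hm'
  · cases hm'; exact absurd hmr.symm hr
  · exact ⟨c, m', hm', hmr, hv⟩

theorem VidState.RetrievalInv.congr {s s' : VidState N Tx Chunk Digest} (h : s.RetrievalInv P)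
    (h1 : s'.result = s.result) (h2 : s'.returned = s.returned) : s'.RetrievalInv P := by
  have hc : ∀ r k, s'.collected P r k = s.collected P r k := fun r k => by
    unfold VidState.collected; rw [h2]
  constructor
  · intro hn r
    have := h.1 (h1 ▸ hn) r
    simpa only [VidState.collectedCount, hc] using this
  · intro x hx
    simpa only [hc] using h.2 x (h1 ▸ hx)

theorem VidState.RetrievalInv.receive {s : VidState N Tx Chunk Digest} (h : s.RetrievalInv P)
    (i : Fin N) (v : VidId N) (src : Fin N) (m : Msg Chunk Digest) :
    (s.receive P i v src m).1.RetrievalInv P := by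
  cases m with
  | returnChunk m =>
    have hext := VidState.receive_extends (P := P) i v src s (.returnChunk m)
    simp only [VidState.receive] at hext ⊢
    by_cases hr : s.retrieving ∧ s.returned src = none
    · simp only [if_pos hr] at hext ⊢
      set s' : VidState N Tx Chunk Digest :=
        { s with returned := Function.update s.returned src (some m) } with hs'
      have hle := VidState.collectedCount_le_succ (P := P) (s := s) (s' := s') (src := src)
        (fun k hk => by simp [hs', hk]) m.root
      by_cases hd : s.result = none ∧
          N - 2 * f ≤ (Finset.univ.filter fun k => s'.collected P m.root k ≠ none).card
      · constructor
        · simp [hd]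
        · intro x hx
          simp only [if_pos hd, Option.some.injEq] at hx
          refine ⟨m.root, s'.collected P m.root, hx.symm, ?_, fun k c hc => hc⟩
          have h1 := h.1 hd.1 m.root
          have h2 := hd.2
          unfold VidState.collectedCount at hle h1
          omega
      · constructor
        · simp only [if_neg hd]
          intro hn r
          by_cases hrm : r = m.root
          · subst hrm
            exact lt_of_not_ge fun hge => hd ⟨hn, hge⟩
          · exact (VidState.collectedCount_le_of_ne (P := P) (s := s) (src := src) rfl hrm).trans_lt
              (h.1 hn r)
        · simp only [if_neg hd] at hext ⊢
          intro x hx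
          obtain ⟨r, C, h1, h2, h3⟩ := h.2 x hx
          -- `C` stays the array used for decoding, while `collected` may grow beyond it.
          exact ⟨r, C, h1, h2, fun k c hc => hext.collected (h3 k c hc)⟩
    · simpa only [if_neg hr] using h
  | _ =>
    refine h.congr ?_ ?_ <;> simp only [VidState.receive] <;> (try split_ifs) <;> rfl

theorem Run.retrievalInv (R : Run P H txs) (hN : 3 * f + 1 ≤ N) {i : Fin N} (hi : i ∈ H)
    (v : VidId N) (t : ℕ) : ((R.state t i).vid v).RetrievalInv P := by
  refine R.vid_induction hi v (Q := fun _ s _ => s.RetrievalInv P) ?_ ?_ t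
  · constructor <;> simp [VidState.collectedCount, VidState.collected]
    omega
  · intro t s em hstep ih
    cases hstep with
    | stay => exact ih
    | receive src m _ => exact ih.receive i v src m
    | respond k m _ _ _ => exact ih.congr rfl rfl
    | retrieve _ => exact ih.congr rfl rfl
    | disperse T V _ _ => exact ih

end Reactive

/-! ### Persistence of node states; proposals and observations. -/

section NodeInvariants

variable {N f : ℕ} {Tx Chunk Digest : Type*} {P : Protocol N f Tx Chunk Digest}
  {H : Finset (Fin N)} {txs : Fin N → ℕ → Tx}

/-- An invariant of the state of a node. -/
theorem Run.node_induction (R : Run P H txs) (i : Fin N)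
    {Q : ℕ → NodeState N Tx Chunk Digest → Prop} (zero : Q 0 {})
    (succ : ∀ t s, R.NodeStep t i s → Q t (R.state t i) → Q (t + 1) s) (t : ℕ) :
    Q t (R.state t i) := by
  induction t with
  | zero => rw [R.state_zero]; exact zero
  | succ t ih => exact succ t _ (R.nodeStep t i) ih

theorem NodeState.mem_chosen {s : NodeState N Tx Chunk Digest} {e : ℕ} {j : Fin N} :
    j ∈ s.chosen e ↔ s.baOut e j = some true := by
  simp [NodeState.chosen]

/-- This makes proposals permanent: `startEpoch` writes into a slot that is still empty. The case `d
= 0` serves to show that proposals belong to positive epochs. -/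
theorem Run.proposed_eq_none (R : Run P H txs) (i : Fin N) (t : ℕ) :
    ∀ d, d = 0 ∨ (R.state t i).epoch < d → (R.state t i).proposed d = none := by
  refine R.node_induction i
    (Q := fun _ s => ∀ d, d = 0 ∨ s.epoch < d → s.proposed d = none) (by simp) ?_ t
  intro t s hstep ih
  cases hstep with
  | stay => exact ih
  | act a _ _ _ =>
    cases a with
    | startEpoch =>
      intro d hd
      simp only [LocalAction.exec] at hd ⊢
      rw [Function.update_of_ne (by omega)]
      exact ih d (by omega)
    | _ => simpa [LocalAction.exec, NodeState.retrieve] using ih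
  | receive src v m _ _ => exact ih
  | output e j b _ => exact ih

/-- The components of the state of a node that are never changed once they are set. -/
structure NodeState.Extends (s s' : NodeState N Tx Chunk Digest) : Prop where
  proposed : ∀ d x, s.proposed d = some x → s'.proposed d = some x
  epoch : s.epoch ≤ s'.epoch
  baIn : ∀ e j b, s.baIn e j = some b → s'.baIn e j = some b
  baOut : ∀ e j b, s.baOut e j = some b → s'.baOut e j = some b
  retrievalStarted : s.retrievalStarted ⊆ s'.retrievalStarted
  finished : s.finished ≤ s'.finished
  delivered : s.delivered ⊆ s'.delivered
  log : s.log ⊆ s'.log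

theorem NodeState.Extends.refl (s : NodeState N Tx Chunk Digest) : s.Extends s := by
  constructor <;> simp

theorem NodeState.Extends.trans {s s' s'' : NodeState N Tx Chunk Digest} (h : s.Extends s')
    (h' : s'.Extends s'') : s.Extends s'' where
  proposed _ _ hx := h'.1 _ _ (h.1 _ _ hx)
  epoch := h.2.trans h'.2
  baIn _ _ _ hx := h'.3 _ _ _ (h.3 _ _ _ hx)
  baOut _ _ _ hx := h'.4 _ _ _ (h.4 _ _ _ hx)
  retrievalStarted _ hx := h'.5 (h.5 hx)
  finished := h.6.trans h'.6
  delivered _ hx := h'.7 (h.7 hx)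
  log _ hx := h'.8 (h.8 hx)

theorem Run.NodeStep.extends {R : Run P H txs} {t : ℕ} {i : Fin N}
    {s : NodeState N Tx Chunk Digest} (h : R.NodeStep t i s) : (R.state t i).Extends s := by
  cases h with
  | stay => exact .refl _
  | act a _ _ hen =>
    cases a with
    | startEpoch =>
      constructor <;> simp [LocalAction.exec]
      intro d T V hd
      rw [Function.update_of_ne, hd]
      rintro rfl
      rw [R.proposed_eq_none i t _ (Or.inr (Nat.lt_succ_self _))] at hd
      cases hd
    | inputOne e j =>
      have := hen.2.2.2
      constructor <;> simp [LocalAction.exec, Function.update_apply]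
      grind
    | inputZero e =>
      constructor <;> simp [LocalAction.exec, Function.update_apply]
      intro e' j
      by_cases h : e' = e
      · subst h; simp +contextual
      · simp [h]
    | deliverChosen =>
      constructor <;> simp [LocalAction.exec, NodeState.retrieve, Set.union_assoc]
    | _ => constructor <;> simp [LocalAction.exec, NodeState.retrieve]
  | receive src v m _ _ => constructor <;> simp [NodeState.receive]
  | output e j b hb =>
    constructor <;> simp [Function.update_apply]
    grind

theorem Run.node_extends (R : Run P H txs) (i : Fin N) {t t' : ℕ} (htt : t ≤ t') :
    (R.state t i).Extends (R.state t' i) := by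
  induction t', htt using Nat.le_induction with
  | base => exact .refl _
  | succ t' _ ih => exact ih.trans (R.nodeStep t' i).extends

theorem Run.Proposes.unique {R : Run P H txs} {i : Fin N} {e : ℕ} {T T' : Tx}
    {V V' : Fin N → ℕ} (h : R.Proposes i e T V) (h' : R.Proposes i e T' V') : T = T' ∧ V = V' := by
  obtain ⟨t, ht⟩ := h
  obtain ⟨t', ht'⟩ := h'
  have h1 := (R.node_extends i (le_max_left t t')).proposed _ _ ht
  have h2 := (R.node_extends i (le_max_right t t')).proposed _ _ ht'
  unfold Run.state at h1 h2
  rw [h1] at h2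
  simpa using h2

theorem Run.complete_mono {R : Run P H txs} {i : Fin N} (hi : i ∈ H) {v : VidId N} {t t' : ℕ}
    (htt : t ≤ t') (h : (R.state t i).Complete v) : (R.state t' i).Complete v :=
  (Run.vid_extends hi v htt).chunkRoot h

theorem Run.exists_proposed (R : Run P H txs) (i : Fin N) (t : ℕ) :
    ∀ d, 1 ≤ d → d ≤ (R.state t i).epoch → (R.state t i).proposed d ≠ none := by
  refine R.node_induction i
    (Q := fun _ s => ∀ d, 1 ≤ d → d ≤ s.epoch → s.proposed d ≠ none) (by simp; omega) ?_ t
  intro t s hstep ih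
  cases hstep with
  | stay => exact ih
  | act a _ _ _ =>
    cases a with
    | startEpoch =>
      intro d hd1 hd
      simp only [LocalAction.exec, Function.update_apply] at hd ⊢
      split_ifs with h
      · simp
      · exact ih d hd1 (by omega)
    | _ => simpa [LocalAction.exec, NodeState.retrieve] using ih
  | receive src v m _ _ => exact ih
  | output e j b _ => exact ih

/-- Each step completes at most one further instance. Finiteness keeps the supremum in
`NodeState.view` from taking its default value `0` on an unbounded set. -/
theorem Run.finite_complete (R : Run P H txs) (i : Fin N) (t : ℕ) :
    {v | (R.state t i).Complete v}.Finite := by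
  refine R.node_induction i (Q := fun _ s => {v | s.Complete v}.Finite)
    (by simp [NodeState.Complete]) ?_ t
  intro t s hstep ih
  cases hstep with
  | stay => exact ih
  | act a _ _ _ =>
    refine ih.subset fun v hv => ?_
    cases a with
    | respond v' k =>
      by_cases h : v = v'
      · subst h; simpa [LocalAction.exec, NodeState.Complete] using hv
      · simpa [LocalAction.exec, NodeState.Complete, h] using hv
    | _ => simpa [LocalAction.exec, NodeState.retrieve, NodeState.Complete] using hv
  | receive src v m _ _ =>
    refine (ih.insert v).subset fun v' hv' => ?_
    by_cases h : v' = v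
    · exact Or.inl h
    · right; simpa [NodeState.receive, NodeState.Complete, h] using hv'
  | output e j b _ => exact ih

theorem Run.bddAbove_view (R : Run P H txs) (i : Fin N) (t : ℕ) (j : Fin N) :
    BddAbove {n | ∀ d, 1 ≤ d → d ≤ n → (R.state t i).Complete (d, j)} := by
  have hfin : {d | (R.state t i).Complete (d, j)}.Finite :=
    (R.finite_complete i t).preimage (f := fun d => (d, j)) (fun a _ b _ h => by simpa using h)
  obtain ⟨b, hb⟩ := hfin.bddAbove
  refine ⟨b, fun n hn => ?_⟩
  rcases Nat.eq_zero_or_pos n with h | h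
  · omega
  · exact hb (hn n h le_rfl)

theorem Run.complete_of_le_view (R : Run P H txs) (i : Fin N) (t : ℕ) {j : Fin N} {d : ℕ}
    (h1 : 1 ≤ d) (h : d ≤ (R.state t i).view j) : (R.state t i).Complete (d, j) :=
  Nat.sSup_mem (s := {n | ∀ d, 1 ≤ d → d ≤ n → (R.state t i).Complete (d, j)})
    ⟨0, by simp; omega⟩ (R.bddAbove_view i t j) d h1 h

/-- The observation was true when it was made, and completion is permanent. An estimation bounded by
a correct observation thus names only completed instances. -/
theorem Run.complete_of_le_proposed (R : Run P H txs) {i : Fin N} (hi : i ∈ H) (t : ℕ) :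
    ∀ e T V, (R.state t i).proposed e = some (T, V) →
      ∀ j d, 1 ≤ d → d ≤ V j → (R.state t i).Complete (d, j) := by
  induction t with
  | zero => rw [R.state_zero]; simp
  | succ t ih =>
    intro e T V hp j d h1 hd
    refine Run.complete_mono hi t.le_succ ?_
    have hstep := R.nodeStep t i
    generalize R.state (t + 1) i = s at hstep hp
    cases hstep with
    | stay => exact ih e T V hp j d h1 hd
    | act a _ _ _ =>
      cases a with
      | startEpoch =>
        simp only [LocalAction.exec, Function.update_apply] at hp
        split_ifs at hp with h
        · simp only [Option.some.injEq, Prod.mk.injEq] at hp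
          exact R.complete_of_le_view i t h1 (hp.2 ▸ hd)
        · exact ih e T V hp j d h1 hd
      | _ => exact ih e T V (by simpa [LocalAction.exec, NodeState.retrieve] using hp) j d h1 hd
    | receive src v m _ _ => exact ih e T V hp j d h1 hd
    | output _ _ b _ => exact ih e T V hp j d h1 hd

/-- What has completed before an epoch is started is seen in the observation for this epoch. -/
theorem Run.le_observation (R : Run P H txs) {i : Fin N} (hi : i ∈ H) {t : ℕ} {j : Fin N}
    {n e : ℕ} (hc : ∀ d, 1 ≤ d → d ≤ n → (R.state t i).Complete (d, j))
    (he : (R.state t i).epoch < e) {T : Tx} {V : Fin N → ℕ} (hp : R.Proposes i e T V) :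
    n ≤ V j := by
  have key : ∀ t', t ≤ t' → ∀ T V, (R.state t' i).proposed e = some (T, V) → n ≤ V j := by
    intro t' htt
    induction t', htt using Nat.le_induction with
    | base =>
      intro T V hp
      -- Epoch `e` is not yet started at time `t`, so its observation is made after the completions
      -- in `hc`.
      rw [R.proposed_eq_none i t e (Or.inr he)] at hp
      cases hp
    | succ t' htt ih =>
      intro T V hp
      have hstep := R.nodeStep t' i
      generalize R.state (t' + 1) i = s at hstep hp
      cases hstep with
      | stay => exact ih T V hp
      | act a _ _ _ =>
        cases a with
        | startEpoch =>
          simp only [LocalAction.exec, Function.update_apply] at hp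
          split_ifs at hp with h
          · simp only [Option.some.injEq, Prod.mk.injEq] at hp
            rw [← hp.2]
            exact le_csSup (R.bddAbove_view i t' j) fun d h1 hd =>
              Run.complete_mono hi htt (hc d h1 hd)
          · exact ih T V hp
        | _ => exact ih T V (by simpa [LocalAction.exec, NodeState.retrieve] using hp)
      | receive src v m _ _ => exact ih T V hp
      | output _ _ b _ => exact ih T V hp
  obtain ⟨t', ht'⟩ := hp
  exact key (max t t') (le_max_left _ _) T V
    ((R.node_extends i (le_max_right t t')).proposed _ _ ht')

/-- The chunk that the `k`-th server is sent when the block `B` is dispersed. -/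
def Protocol.provenChunk (P : Protocol N f Tx Chunk Digest) (B : Block N Tx) (k : Fin N) :
    ProvenChunk Chunk Digest :=
  ⟨merkleRoot P.hash (P.code.encode B), P.code.encode B k, merkleProof P.hash (P.code.encode B) k⟩

theorem Run.sent_of_proposed (R : Run P H txs) (i : Fin N) (t : ℕ) :
    ∀ e T V, (R.state t i).proposed e = some (T, V) →
      ∀ k, R.Sent t i k (e, i) (.chunk (P.provenChunk (.formatted T V) k)) := by
  induction t with
  | zero => rw [R.state_zero]; simp
  | succ t ih =>
    intro e T V hp k
    have hstep := R.nodeStep t i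
    have hnext := R.next t
    generalize R.state (t + 1) i = s at hstep hp
    cases hstep with
    | stay => exact Run.sent_succ (ih e T V hp k)
    | act a _ ha _ =>
      cases a with
      | startEpoch =>
        simp only [LocalAction.exec, Function.update_apply] at hp
        split_ifs at hp with h
        · simp only [Option.some.injEq, Prod.mk.injEq] at hp
          rw [ha] at hnext
          unfold Run.Sent
          rw [Run.net_of_update hnext]
          right
          obtain ⟨rfl, rfl⟩ := hp
          subst h
          exact ⟨rfl, rfl⟩
        · exact Run.sent_succ (ih e T V hp k)
      | _ => exact Run.sent_succ
              (ih e T V (by simpa [LocalAction.exec, NodeState.retrieve] using hp) k)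
    | receive src v m _ _ => exact Run.sent_succ (ih e T V hp k)
    | output _ _ b _ => exact Run.sent_succ (ih e T V hp k)

theorem Run.chunk_eq_of_sent (R : Run P H txs) {i k : Fin N} (hi : i ∈ H) {v : VidId N} {t : ℕ}
    {m : ProvenChunk Chunk Digest} (h : R.Sent t i k v (.chunk m)) : v.2 = i ∧
      ∃ T V, R.Proposes i v.1 T V ∧ m = P.provenChunk (.formatted T V) k := by
  obtain ⟨h1, t', _, T, V, hp, hm⟩ := (R.justified hi v t).chunk k m h
  exact ⟨h1, T, V, ⟨t', hp⟩, Msg.chunk.inj hm.2⟩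

end NodeInvariants

open Filter

/-! ### Quorum intersection: uniqueness of the root. -/

section Agreement

variable {N f : ℕ} {Tx Chunk Digest : Type*} {P : Protocol N f Tx Chunk Digest}
  {H : Finset (Fin N)} {txs : Fin N → ℕ → Tx} {R : Run P H txs}

theorem exists_correct_of_readyCount (hH : (Hᶜ).card ≤ f) {s : VidState N Tx Chunk Digest}
    {r : Digest} (h : f + 1 ≤ s.readyCount r) : ∃ q ∈ H, s.readyFrom q = some r := by
  obtain ⟨q, hq, hqr⟩ := exists_mem_of_card_compl_lt (H := H)
    (Finset.univ.filter fun k => s.readyFrom k = some r) (by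
      unfold VidState.readyCount at h; omega)
  exact ⟨q, hq, by simpa using hqr⟩

/-- The correct servers that have received a chunk with a valid proof under the root `r`. -/
noncomputable def Run.holders (R : Run P H txs) (t : ℕ) (v : VidId N) (r : Digest) :
    Finset (Fin N) :=
  H ∩ Finset.univ.filter fun q => ∃ m, ((R.state t q).vid v).mine P q = some m ∧ m.root = r

theorem Run.mem_holders {t : ℕ} {v : VidId N} {r : Digest} {q : Fin N} : q ∈ R.holders t v r ↔
    q ∈ H ∧ ∃ m, ((R.state t q).vid v).mine P q = some m ∧ m.root = r := by
  simp [Run.holders]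

theorem Run.holders_mono {t t' : ℕ} (htt : t ≤ t') (v : VidId N) (r : Digest) :
    R.holders t v r ⊆ R.holders t' v r := by
  intro q hq
  rw [Run.mem_holders] at hq ⊢
  exact ⟨hq.1, hq.2.imp fun m hm => ⟨(Run.vid_extends hq.1 v htt).mine hm.1, hm.2⟩⟩

/-- A chain of `Ready` messages that rely on earlier `Ready` messages must start with one that
relies on `N - f` `GotChunk` messages, whose correct senders are holders. The actual number of
faulty nodes is kept in the bound: with `f` in its place, the two quorums of `Run.ready_unique`
would contradict only `N > 4f`. -/
theorem Run.card_holders_of_ready (hH : (Hᶜ).card ≤ f) (t : ℕ) :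
    ∀ i ∈ H, ∀ k v r, R.Sent t i k v (.ready r) →
      N - f ≤ (R.holders t v r).card + (Hᶜ).card := by
  induction t with
  | zero => exact fun i _ k v r h => absurd h (R.not_sent_zero _ _ _ _)
  | succ t ih =>
    intro i hi k v r h
    have hmono := Finset.card_le_card (R.holders_mono (Nat.le_add_right t 1) v r)
    have hrec := R.recorded_pred hi v (t + 1)
    rcases (R.justified hi v (t + 1)).ready k r h with h | h
    · refine (h.trans (card_le_inter_add_compl (H := H) _)).trans
        (Nat.add_le_add_right (Finset.card_le_card fun q hq => ?_) _)
      simp only [Finset.mem_inter, Finset.mem_filter, Finset.mem_univ, true_and] at hq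
      refine R.holders_mono t.le_succ v r (Run.mem_holders.2 ⟨hq.1, ?_⟩)
      exact (R.justified hq.1 v t).gotChunk _ _ (hrec.gotFrom _ _ hq.2)
    -- One of the `f + 1` senders is correct and sent its `Ready` by time `t`.
    · obtain ⟨q, hq, hqr⟩ := exists_correct_of_readyCount hH h
      have := ih q hq _ v r (hrec.readyFrom _ _ hqr)
      omega

/-- Correct servers do not announce two roots as ready in one instance. -/
theorem Run.ready_unique (hN : 3 * f + 1 ≤ N) (hH : (Hᶜ).card ≤ f) {t : ℕ} {v : VidId N}
    {i i' k k' : Fin N} (hi : i ∈ H) (hi' : i' ∈ H) {r r' : Digest}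
    (h : R.Sent t i k v (.ready r)) (h' : R.Sent t i' k' v (.ready r')) : r = r' := by
  have h1 := Run.card_holders_of_ready hH t i hi k v r h
  have h2 := Run.card_holders_of_ready hH t i' hi' k' v r' h'
  by_contra hne
  have hdisj : Disjoint (R.holders t v r) (R.holders t v r') := by
    rw [Finset.disjoint_left]
    intro q hq hq'
    rw [Run.mem_holders] at hq hq'
    obtain ⟨_, m, hm, rfl⟩ := hq
    obtain ⟨_, m', hm', rfl⟩ := hq'
    rw [hm] at hm'
    exact hne (by cases hm'; rfl)
  have hsub : R.holders t v r ∪ R.holders t v r' ⊆ H :=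
    Finset.union_subset Finset.inter_subset_left Finset.inter_subset_left
  have h3 := Finset.card_le_card hsub
  rw [Finset.card_union_of_disjoint hdisj] at h3
  -- Both holder sets inside `H` would give `2 * (N - f) ≤ H.card + 2 * (Hᶜ).card ≤ N + f`, against
  -- `3 * f + 1 ≤ N`.
  have h4 := card_add_card_compl_fin (H := H)
  omega

theorem Run.exists_ready_of_readyCount (hH : (Hᶜ).card ≤ f) {t : ℕ} {i : Fin N} (hi : i ∈ H)
    {v : VidId N} {r : Digest} (h : f + 1 ≤ ((R.state t i).vid v).readyCount r) :
    ∃ q ∈ H, R.Sent t q i v (.ready r) := by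
  obtain ⟨q, hq, hqr⟩ := exists_correct_of_readyCount hH h
  exact ⟨q, hq, (R.recorded hi v t).readyFrom _ _ hqr⟩

/-- All correct servers agree on the root of the dispersed chunks. -/
theorem Run.root_unique (hN : 3 * f + 1 ≤ N) (hH : (Hᶜ).card ≤ f) {t t' : ℕ} {i i' : Fin N}
    (hi : i ∈ H) (hi' : i' ∈ H) {v : VidId N} {r r' : Digest}
    (h : f + 1 ≤ ((R.state t i).vid v).readyCount r)
    (h' : f + 1 ≤ ((R.state t' i').vid v).readyCount r') : r = r' := by
  obtain ⟨q, hq, hqr⟩ := Run.exists_ready_of_readyCount hH hi h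
  obtain ⟨q', hq', hqr'⟩ := Run.exists_ready_of_readyCount hH hi' h'
  exact Run.ready_unique hN hH hq hq' (Run.sent_mono (le_max_left t t') hqr)
    (Run.sent_mono (le_max_right t t') hqr')

end Agreement

/-! ### Termination of dispersal and retrieval under fairness. -/

section Liveness

variable {N f : ℕ} {Tx Chunk Digest : Type*} {P : Protocol N f Tx Chunk Digest}
  {H : Finset (Fin N)} {txs : Fin N → ℕ → Tx} {R : Run P H txs}

theorem eventually_of_succ {p : ℕ → Prop} (h : ∀ t, p t → p (t + 1)) {t : ℕ} (ht : p t) :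
    ∀ᶠ t in atTop, p t :=
  eventually_atTop.2 ⟨t, fun _ htt => monotone_of_succ h htt ht⟩

/-- A message between correct nodes is received. -/
theorem Run.Fair.exists_receive (hfair : R.Fair) {t : ℕ} {src dst : Fin N} (hsrc : src ∈ H)
    (hdst : dst ∈ H) {v : VidId N} {m : Msg Chunk Digest} (h : R.Sent t src dst v m) :
    ∃ t', R.Sent t' src dst v m ∧ (R.state (t' + 1) dst).vid v =
      (((R.state t' dst).vid v).receive P dst v src m).1 := by
  obtain ⟨t', ht'⟩ := hfair.delivery t _ h hsrc hdst
  have hen := R.enabled t'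
  rw [ht'] at hen
  refine ⟨t', hen.2, ?_⟩
  unfold Run.state
  rw [R.next t', ht']
  simp [Action.exec, Config.update, NodeState.receive]

/-- A step that stays enabled until its purpose is served is taken, unless the purpose is served
otherwise. -/
theorem Run.Fair.eventually_of_enabled (hfair : R.Fair) {i : Fin N} (hi : i ∈ H)
    (a : LocalAction N) {q : ℕ → Prop} (hq : ∀ t, q t → q (t + 1))
    (hen : ∀ᶠ t in atTop, q t ∨ a.Enabled P i (R.state t i))
    (hstep : ∀ᶠ t in atTop, a.Enabled P i (R.state t i) →
      R.config (t + 1) = (R.config t).update i (a.exec P i (txs i) (R.state t i)) → q (t + 1)) :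
    ∀ᶠ t in atTop, q t := by
  obtain ⟨T, hT⟩ := eventually_atTop.1 (hen.and hstep)
  rcases (hT T le_rfl).1 with h | h
  · exact eventually_of_succ hq h
  · obtain ⟨t', htt, ht' | ht'⟩ := hfair.progress i hi a T h
    · have hnext := R.next t'
      have hena := R.enabled t'
      rw [ht'] at hnext hena
      exact eventually_of_succ hq ((hT t' htt).2 hena.2 hnext)
    · exact eventually_of_succ hq ((hT t' htt).1.resolve_right ht')

/-- The receiver records the first `GotChunk` of each sender, possibly another message than this
one. A correct sender, however, announces only the root of its one stored chunk. -/
theorem Run.Fair.eventually_gotFrom (hfair : R.Fair) {t : ℕ} {src dst : Fin N} (hsrc : src ∈ H)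
    (hdst : dst ∈ H) {v : VidId N} {r : Digest} (h : R.Sent t src dst v (.gotChunk r)) :
    ∀ᶠ t in atTop, ((R.state t dst).vid v).gotFrom src = some r := by
  obtain ⟨t', hsent, hrec⟩ := hfair.exists_receive hsrc hdst h
  have hne : ((R.state (t' + 1) dst).vid v).gotFrom src ≠ none := by
    rw [hrec]; simp only [VidState.receive]; split_ifs with hn <;> simp [hn]
  obtain ⟨r', hr'⟩ := Option.ne_none_iff_exists'.1 hne
  obtain ⟨m, hm, hmr⟩ := (R.justified hsrc v _).gotChunk _ _ (Run.sent_succ hsent)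
  obtain ⟨m', hm', hmr'⟩ := (R.justified hsrc v _).gotChunk _ _
    ((R.recorded hdst v _).gotFrom _ _ hr')
  obtain rfl : m = m' := by rw [hm] at hm'; cases hm'; rfl
  refine eventually_of_succ (p := fun t => ((R.state t dst).vid v).gotFrom src = some r)
    (fun t ht => (Run.vid_extends hdst v t.le_succ).gotFrom _ _ ht) (t := t' + 1) ?_
  rw [hr', ← hmr', hmr]

/-- The recorded first `Ready` may again be another message; here `Run.ready_unique` shows that it
carries the same root. -/
theorem Run.Fair.eventually_readyFrom (hfair : R.Fair) (hN : 3 * f + 1 ≤ N) (hH : (Hᶜ).card ≤ f)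
    {t : ℕ} {src dst : Fin N} (hsrc : src ∈ H) (hdst : dst ∈ H) {v : VidId N} {r : Digest}
    (h : R.Sent t src dst v (.ready r)) :
    ∀ᶠ t in atTop, ((R.state t dst).vid v).readyFrom src = some r := by
  obtain ⟨t', hsent, hrec⟩ := hfair.exists_receive hsrc hdst h
  have hne : ((R.state (t' + 1) dst).vid v).readyFrom src ≠ none := by
    rw [hrec]; simp only [VidState.receive]; split_ifs with hn <;> simp [hn]
  obtain ⟨r', hr'⟩ := Option.ne_none_iff_exists'.1 hne
  obtain rfl : r = r' := Run.ready_unique hN hH hsrc hsrc (Run.sent_succ hsent)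
    ((R.recorded hdst v _).readyFrom _ _ hr')
  exact eventually_of_succ (p := fun t => ((R.state t dst).vid v).readyFrom src = some r)
    (fun t ht => (Run.vid_extends hdst v t.le_succ).readyFrom _ _ ht) hr'

theorem Run.Fair.eventually_chunkMsg (hfair : R.Fair) {src dst : Fin N} (hsrc : src ∈ H)
    (hdst : dst ∈ H) {e : ℕ} {T : Tx} {V : Fin N → ℕ} (h : R.Proposes src e T V) :
    ∀ᶠ t in atTop, ((R.state t dst).vid (e, src)).chunkMsg =
      some (P.provenChunk (.formatted T V) dst) := by
  have h' := h
  obtain ⟨t, ht⟩ := h'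
  obtain ⟨t', hsent, hrec⟩ := hfair.exists_receive hsrc hdst
    (R.sent_of_proposed src t e T V ht dst)
  have hne : ((R.state (t' + 1) dst).vid (e, src)).chunkMsg ≠ none := by
    rw [hrec]; simp only [VidState.receive]; split_ifs with hn <;> simp_all
  obtain ⟨m, hm⟩ := Option.ne_none_iff_exists'.1 hne
  obtain ⟨_, T', V', hp, hm'⟩ := R.chunk_eq_of_sent hsrc
    ((R.recorded hdst (e, src) _).chunkMsg _ hm)
  obtain ⟨rfl, rfl⟩ := h.unique hp
  refine eventually_of_succ (p := fun t => ((R.state t dst).vid (e, src)).chunkMsg = _)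
    (fun t ht => (Run.vid_extends hdst _ t.le_succ).chunkMsg _ ht) (t := t' + 1) ?_
  rw [hm, hm']

/-- The answer is not ignored: it presupposes a request, and a correct client sends requests only
when it is retrieving. The first recorded answer is the same, since both are the chunk stored at
`src`. -/
theorem Run.Fair.eventually_returned (hfair : R.Fair)
    {t : ℕ} {src dst : Fin N} (hsrc : src ∈ H) (hdst : dst ∈ H) {v : VidId N}
    {m : ProvenChunk Chunk Digest} (h : R.Sent t src dst v (.returnChunk m)) :
    ∀ᶠ t in atTop, ((R.state t dst).vid v).returned src = some m := by
  obtain ⟨t', hsent, hrec⟩ := hfair.exists_receive hsrc hdst h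
  obtain ⟨hm, _, hreq⟩ := (R.justified hsrc v _).returnChunk _ _ hsent
  have hret := (R.justified hdst v _).requestChunk _ hreq
  have hne : ((R.state (t' + 1) dst).vid v).returned src ≠ none := by
    rw [hrec]; simp only [VidState.receive]
    by_cases hn : ((R.state t' dst).vid v).returned src = none
    · rw [if_pos ⟨hret, hn⟩]; simp
    · rw [if_neg (fun h => hn h.2)]; exact hn
  obtain ⟨m', hm'⟩ := Option.ne_none_iff_exists'.1 hne
  have h1 := ((R.justified hsrc v _).returnChunk _ _
    ((R.recorded hdst v _).returned _ _ hm')).1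
  rw [(Run.vid_extends hsrc v t'.le_succ).mine hm] at h1
  cases h1
  exact eventually_of_succ (p := fun t => ((R.state t dst).vid v).returned src = some m)
    (fun t ht => (Run.vid_extends hdst v t.le_succ).returned _ _ ht) hm'

/-- The message to `k` shows that a threshold is met (`Run.justified`), and a met threshold implies
a broadcast (`Run.reactive`). -/
theorem Run.ready_to_all (hN : 3 * f + 1 ≤ N) {t : ℕ} {q k : Fin N} (hq : q ∈ H) {v : VidId N}
    {r : Digest} (h : R.Sent t q k v (.ready r)) (k' : Fin N) : R.Sent t q k' v (.ready r) :=
  (R.reactive hN hq v t).ready r ((R.justified hq v t).ready k r h) k'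

theorem Run.Fair.eventually_le_readyCount (hfair : R.Fair) (hN : 3 * f + 1 ≤ N)
    (hH : (Hᶜ).card ≤ f) {A : Finset (Fin N)} (hA : A ⊆ H) {v : VidId N} {r : Digest}
    (h : ∀ q ∈ A, ∃ t k, R.Sent t q k v (.ready r)) {i : Fin N} (hi : i ∈ H) :
    ∀ᶠ t in atTop, A.card ≤ ((R.state t i).vid v).readyCount r := by
  have h1 : ∀ᶠ t in atTop, ∀ q ∈ A, ((R.state t i).vid v).readyFrom q = some r := by
    refine (eventually_all_finset A).2 fun q hq => ?_
    obtain ⟨t, k, hs⟩ := h q hq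
    exact hfair.eventually_readyFrom hN hH (hA hq) hi (Run.ready_to_all hN (hA hq) hs i)
  filter_upwards [h1] with t ht
  exact Finset.card_le_card fun q hq => by simpa using ht q hq

theorem Run.Fair.eventually_complete_of_ready (hfair : R.Fair) (hN : 3 * f + 1 ≤ N)
    (hH : (Hᶜ).card ≤ f) {v : VidId N} {r : Digest}
    (h : ∀ q ∈ H, ∃ t k, R.Sent t q k v (.ready r)) {i : Fin N} (hi : i ∈ H) :
    ∀ᶠ t in atTop, (R.state t i).Complete v := by
  filter_upwards [hfair.eventually_le_readyCount hN hH (Finset.Subset.refl H) h hi] with t ht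
  have := card_add_card_compl_fin (H := H)
  exact (R.reactive hN hi v t).complete r (by omega)

/-- If the dispersal has completed at one correct server, it completes at all of them. -/
theorem Run.Fair.eventually_complete (hfair : R.Fair) (hN : 3 * f + 1 ≤ N) (hH : (Hᶜ).card ≤ f)
    {v : VidId N} {t : ℕ} {i : Fin N} (hi : i ∈ H) (hc : (R.state t i).Complete v) {k : Fin N}
    (hk : k ∈ H) : ∀ᶠ t in atTop, (R.state t k).Complete v := by
  obtain ⟨r, hr⟩ := Option.ne_none_iff_exists'.1 hc
  have hcount := Run.readyCount_of_chunkRoot R hi v t r hr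
  set A := H ∩ Finset.univ.filter fun q => ((R.state t i).vid v).readyFrom q = some r with hAdef
  have hA : f + 1 ≤ A.card := by
    have : _ ≤ A.card + _ := card_le_inter_add_compl (H := H)
      (Finset.univ.filter fun q => ((R.state t i).vid v).readyFrom q = some r)
    unfold VidState.readyCount at hcount
    omega
  refine hfair.eventually_complete_of_ready hN hH (r := r) (fun q hq => ?_) hk
  -- Amplification: the `f + 1` correct senders in `A` reach every correct `q`, which becomes ready
  -- itself. All of `H` being ready exceeds the threshold `2f + 1`.
  obtain ⟨t', ht'⟩ := (hfair.eventually_le_readyCount hN hH (A := A) Finset.inter_subset_left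
    (fun p hp => ⟨t, i, (R.recorded hi v t).readyFrom _ _ (by simpa using
      (Finset.mem_inter.1 hp).2)⟩) hq).exists
  exact ⟨t', k, (R.reactive hN hq v t').ready r (Or.inr (hA.trans ht')) k⟩

/-- The dispersal of a correct node completes at every correct server. -/
theorem Run.Fair.eventually_complete_of_proposes (hfair : R.Fair) (hN : 3 * f + 1 ≤ N)
    (hH : (Hᶜ).card ≤ f) {j : Fin N} (hj : j ∈ H) {e : ℕ} {T : Tx} {V : Fin N → ℕ}
    (h : R.Proposes j e T V) {i : Fin N} (hi : i ∈ H) :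
    ∀ᶠ t in atTop, (R.state t i).Complete (e, j) := by
  set r := merkleRoot P.hash (P.code.encode (.formatted T V)) with hr
  have hgot : ∀ q ∈ H, ∀ k, ∃ t, R.Sent t q k (e, j) (.gotChunk r) := by
    intro q hq k
    obtain ⟨t, ht⟩ := (hfair.eventually_chunkMsg hj hq h).exists
    exact ⟨t, (R.reactive hN hq (e, j) t).gotChunk _
      (VidState.mine_eq_some.2 ⟨ht, validProof_merkleProof _ _⟩) k⟩
  refine hfair.eventually_complete_of_ready hN hH (r := r) (fun q hq => ?_) hi
  have h1 : ∀ᶠ t in atTop, ∀ p ∈ H, ((R.state t q).vid (e, j)).gotFrom p = some r :=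
    (eventually_all_finset H).2 fun p hp =>
      (hgot p hp q).elim fun t ht => hfair.eventually_gotFrom hp hq ht
  obtain ⟨t, ht⟩ := h1.exists
  refine ⟨t, q, (R.reactive hN hq (e, j) t).ready r (Or.inl ?_) q⟩
  have h2 : H.card ≤ ((R.state t q).vid (e, j)).shareCount r :=
    Finset.card_le_card fun p hp => by simpa using ht p hp
  have := card_add_card_compl_fin (H := H)
  omega

/-- A correct server answers a request when the dispersal has completed with the root of its
chunk. -/
theorem Run.Fair.exists_returnChunk (hfair : R.Fair) {q k : Fin N} (hq : q ∈ H) (hk : k ∈ H)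
    {v : VidId N} {t : ℕ} (hsent : R.Sent t k q v .requestChunk) {m : ProvenChunk Chunk Digest}
    (hm : ∀ᶠ t in atTop, ((R.state t q).vid v).mine P q = some m)
    (hr : ∀ᶠ t in atTop, ((R.state t q).vid v).chunkRoot = some m.root) :
    ∃ t, R.Sent t q k v (.returnChunk m) := by
  obtain ⟨t1, _, hrec⟩ := hfair.exists_receive hk hq hsent
  have huniq : ∀ t m', ((R.state t q).vid v).mine P q = some m' → m' = m := by
    intro t m' hm'
    obtain ⟨t2, ht2⟩ := eventually_atTop.1 hm
    have h1 := (Run.vid_extends hq v (le_max_left t t2)).mine hm'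
    rw [ht2 _ (le_max_right t t2)] at h1
    cases h1; rfl
  -- A pending request disappears only by being answered.
  have hstable : ∀ t,
      (k ∈ ((R.state t q).vid v).requests ∨ R.Sent t q k v (.returnChunk m)) →
      k ∈ ((R.state (t + 1) q).vid v).requests ∨ R.Sent (t + 1) q k v (.returnChunk m) := by
    rintro t (h | h)
    swap
    · exact Or.inr (Run.sent_succ h)
    obtain ⟨em, hstep, hnet⟩ := R.vidStep t hq v
    rw [hnet]
    generalize (R.state (t + 1) q).vid v = s at hstep
    cases hstep with
    | stay => exact Or.inl h
    | receive src m' _ =>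
      left
      cases m' <;> simp only [VidState.receive] <;> (try split_ifs) <;>
        first | exact h | exact Set.mem_insert_of_mem _ h
    | respond k' m' _ hm' _ =>
      by_cases hkk : k = k'
      · subst hkk; right; right; exact ⟨rfl, rfl, by rw [huniq t m' hm']⟩
      · left; exact ⟨h, hkk⟩
    | retrieve _ => exact Or.inl h
    | disperse T V _ _ => exact Or.inl h
  have hev := eventually_of_succ hstable (t := t1 + 1) (Or.inl (by
    rw [hrec]; exact Set.mem_insert _ _))
  refine (hfair.eventually_of_enabled hq (.respond v k)
    (q := fun t => R.Sent t q k v (.returnChunk m)) (fun _ => Run.sent_succ) ?_ ?_).exists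
  · filter_upwards [hev, hm, hr] with t h1 h2 h3
    exact h1.symm.imp_right fun h1 => ⟨h1, m, h2, h3⟩
  · refine .of_forall ?_
    rintro t ⟨_, m', hm', _⟩ hnext
    unfold Run.Sent
    rw [Run.net_of_update hnext]
    right
    exact ⟨rfl, rfl, m', hm', by rw [huniq t m' hm']⟩

/-- A retrieval by a correct client ends if the dispersal has completed at some correct server. -/
theorem Run.Fair.eventually_result (hfair : R.Fair) (hN : 3 * f + 1 ≤ N) (hH : (Hᶜ).card ≤ f)
    {v : VidId N} {t : ℕ} {i : Fin N} (hi : i ∈ H) (hc : (R.state t i).Complete v) {k : Fin N}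
    (hk : k ∈ H) {t' : ℕ} (hret : ((R.state t' k).vid v).retrieving) :
    ∀ᶠ t in atTop, ((R.state t k).vid v).result ≠ none := by
  obtain ⟨r, hr⟩ := Option.ne_none_iff_exists'.1 hc
  have hcount := Run.readyCount_of_chunkRoot R hi v t r hr
  obtain ⟨p, hp, hpr⟩ := Run.exists_ready_of_readyCount hH hi (le_trans (by omega) hcount)
  have hhold := Run.card_holders_of_ready hH t p hp i v r hpr
  have hroot : ∀ q ∈ H, ∀ᶠ t in atTop, ((R.state t q).vid v).chunkRoot = some r := by
    intro q hq
    filter_upwards [hfair.eventually_complete hN hH hi hc hq] with t' ht'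
    obtain ⟨r', hr'⟩ := Option.ne_none_iff_exists'.1 ht'
    have h1 := Run.readyCount_of_chunkRoot R hq v t' r' hr'
    rw [hr', Run.root_unique hN hH hq hi (le_trans (by omega) h1) (le_trans (by omega) hcount)]
  -- The holders at the fixed time `t` are at least `N - 2 * f` correct servers, and each of them
  -- answers with its chunk. An unfinished retrieval would have collected fewer.
  have hall : ∀ᶠ t' in atTop, ∀ q ∈ R.holders t v r, ((R.state t' k).vid v).collected P r q ≠ none := by
    refine (eventually_all_finset _).2 fun q hq => ?_
    obtain ⟨hqH, m, hm, rfl⟩ := Run.mem_holders.1 hq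
    obtain ⟨t2, ht2⟩ := hfair.exists_returnChunk hqH hk ((R.reactive hN hk v t').request hret q)
      (m := m) (eventually_atTop.2 ⟨t, fun t' ht' => (Run.vid_extends hqH v ht').mine hm⟩)
      (hroot q hqH)
    filter_upwards [hfair.eventually_returned hqH hk ht2] with t3 ht3
    exact Option.ne_none_iff_exists'.2 ⟨m.chunk, VidState.collected_eq_some.2
      ⟨m, ht3, rfl, (VidState.mine_eq_some.1 hm).2, rfl⟩⟩
  filter_upwards [hall] with t' ht' hnone
  have h1 := (R.retrievalInv hN hk v t').count_lt hnone r
  have h2 : (R.holders t v r).card ≤ ((R.state t' k).vid v).collectedCount P r :=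
    Finset.card_le_card fun q hq => by simpa using ht' q hq
  omega

/-- What is retrieved from the instance of a correct node is the block proposed by this node. -/
theorem Run.result_eq (hN : 3 * f + 1 ≤ N) (hH : (Hᶜ).card ≤ f) (hhash : R.CollisionFree)
    {v : VidId N} (hv : v.2 ∈ H) {k : Fin N} (hk : k ∈ H) {t : ℕ} {x : Retrieved N Tx}
    (hx : ((R.state t k).vid v).result = some x) :
    ∃ T V, R.Proposes v.2 v.1 T V ∧ x = .block (.formatted T V) := by
  obtain ⟨r, C, rfl, hcard, hC⟩ := (R.retrievalInv hN hk v t).result x hx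
  have hmine : ∀ q ∈ H, C q ≠ none → ∃ T V, R.Proposes v.2 v.1 T V ∧
      r = merkleRoot P.hash (P.code.encode (.formatted T V)) := by
    intro q hq hCq
    obtain ⟨c, hc⟩ := Option.ne_none_iff_exists'.1 hCq
    obtain ⟨m, hm, rfl, hvalid, rfl⟩ := VidState.collected_eq_some.1 (hC q c hc)
    have h1 := ((R.justified hq v t).returnChunk _ _ ((R.recorded hk v t).returned _ _ hm)).1
    obtain ⟨_, T, V, hp, rfl⟩ := R.chunk_eq_of_sent hv
      ((R.recorded hq v t).chunkMsg _ (VidState.mine_eq_some.1 h1).1)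
    exact ⟨T, V, hp, rfl⟩
  -- Since `N - 2 * f > f`, one of the decoded chunks was returned by a correct server, which had it
  -- from the owner. This identifies the root `r`.
  obtain ⟨q, hq, hqC⟩ := exists_mem_of_card_compl_lt (H := H)
    (Finset.univ.filter fun k => C k ≠ none) (by omega)
  obtain ⟨T, V, hp, rfl⟩ := hmine q hq (by simpa using hqC)
  have htree : treeInputs P.hash (P.code.encode (.formatted T V)) ⊆ R.hashed v := by
    intro y hy
    obtain ⟨t', ht'⟩ := hp
    exact ⟨t', v.2, hv, Or.inl ⟨T, V, rfl, ht', hy⟩⟩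
  have hCeq : C = fun q => if q ∈ Finset.univ.filter fun k => C k ≠ none then
      some (P.code.encode (.formatted T V) q) else none := by
    funext q
    split_ifs with hq
    · obtain ⟨c, hc⟩ := Option.ne_none_iff_exists'.1 (show C q ≠ none by simpa using hq)
      obtain ⟨m, hm, hmr, hvalid, rfl⟩ := VidState.collected_eq_some.1 (hC q c hc)
      -- Chunks from faulty servers are covered as well: the checked proof and the disperser's tree
      -- are hashed within the same instance.
      rw [hc, ← ValidProof.chunk_eq (hhash v) htree (hmr ▸ hvalid) fun y hy =>
        ⟨t, k, hk, Or.inr (Or.inr ⟨m, q, hm, hy⟩)⟩]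
    · simpa using hq
  have hdec : P.code.decode C = .formatted T V := by
    rw [hCeq]
    exact P.code.decode_encode _ _ hcard
  exact ⟨T, V, hp, by rw [reconstruct, hdec, if_pos rfl]⟩

end Liveness

/-! ### Progress through the epochs: the common-subset argument. -/

section Epochs

variable {N f : ℕ} {Tx Chunk Digest : Type*} {P : Protocol N f Tx Chunk Digest}
  {H : Finset (Fin N)} {txs : Fin N → ℕ → Tx} {R : Run P H txs}

theorem NodeState.Extends.chosen {s s' : NodeState N Tx Chunk Digest} (h : s.Extends s') (e : ℕ) :
    s.chosen e ⊆ s'.chosen e := by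
  intro j hj
  rw [NodeState.mem_chosen] at hj ⊢
  exact h.baOut _ _ _ hj

theorem NodeState.Extends.baOut_ne_none {s s' : NodeState N Tx Chunk Digest} (h : s.Extends s')
    {e : ℕ} {j : Fin N} (hj : s.baOut e j ≠ none) : s'.baOut e j ≠ none := by
  obtain ⟨b, hb⟩ := Option.ne_none_iff_exists'.1 hj
  simp [h.baOut _ _ _ hb]

theorem NodeState.Extends.baIn_ne_none {s s' : NodeState N Tx Chunk Digest} (h : s.Extends s')
    {e : ℕ} {j : Fin N} (hj : s.baIn e j ≠ none) : s'.baIn e j ≠ none := by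
  obtain ⟨b, hb⟩ := Option.ne_none_iff_exists'.1 hj
  simp [h.baIn _ _ _ hb]

theorem NodeState.AllOutput.chosen_eq {s s' : NodeState N Tx Chunk Digest} {e : ℕ}
    (h : s.AllOutput e) (hs : s.Extends s') : s'.chosen e = s.chosen e := by
  refine Finset.Subset.antisymm (fun j hj => ?_) (hs.chosen e)
  rw [NodeState.mem_chosen] at hj ⊢
  obtain ⟨b, hb⟩ := Option.ne_none_iff_exists'.1 (h j)
  rw [hs.baOut _ _ _ hb] at hj
  rw [hb, hj]

theorem NodeState.AllOutput.mono {s s' : NodeState N Tx Chunk Digest} {e : ℕ}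
    (h : s.AllOutput e) (hs : s.Extends s') : s'.AllOutput e :=
  fun j => hs.baOut_ne_none (h j)

/-- What the inputs of a correct node to Binary Agreement mean. -/
theorem Run.input_inv (R : Run P H txs) {i : Fin N} (hi : i ∈ H) (t : ℕ) (e : ℕ) (j : Fin N) :
    ((R.state t i).baIn e j = some true → (R.state t i).Complete (e, j)) ∧
      ((R.state t i).baIn e j = some false → N - f ≤ ((R.state t i).chosen e).card) := by
  induction t with
  | zero => rw [R.state_zero]; simp
  | succ t ih =>
    suffices h : ((R.state (t + 1) i).baIn e j = some true → (R.state t i).Complete (e, j)) ∧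
        ((R.state (t + 1) i).baIn e j = some false → N - f ≤ ((R.state t i).chosen e).card) from
      ⟨fun h1 => Run.complete_mono hi t.le_succ (h.1 h1), fun h1 => (h.2 h1).trans
        (Finset.card_le_card ((R.node_extends i (Nat.le_add_right t 1)).chosen e))⟩
    have hstep := R.nodeStep t i
    generalize R.state (t + 1) i = s at hstep
    cases hstep with
    | stay => exact ih
    | act a _ _ hen =>
      cases a with
      | inputOne e' j' =>
        by_cases h : e = e' ∧ j = j'
        · obtain ⟨rfl, rfl⟩ := h
          simpa [LocalAction.exec] using hen.2.2.1
        · have : (LocalAction.exec P i (txs i) (R.state t i) (.inputOne e' j')).1.baIn e j =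
              (R.state t i).baIn e j := by
            simp only [LocalAction.exec, Function.update_apply]
            grind
          rwa [this]
      | inputZero e' =>
        by_cases h : e = e'
        · subst h
          simp only [LocalAction.exec, Function.update_self]
          split_ifs with hn
          · exact ⟨by simp, fun _ => hen.2.2.1⟩
          · exact ih
        · simpa [LocalAction.exec, h] using ih
      | _ => simpa [LocalAction.exec, NodeState.retrieve] using ih
    | receive src v m _ _ => exact ih
    | output e j b _ => exact ih

theorem Run.baOut_eq {i : Fin N} {t t' : ℕ} {e : ℕ} {j : Fin N} {b b' : Bool}
    (h : (R.state t i).baOut e j = some b) (h' : (R.state t' i).baOut e j = some b') : b = b' := by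
  have h1 := (R.node_extends i (le_max_left t t')).baOut _ _ _ h
  rw [(R.node_extends i (le_max_right t t')).baOut _ _ _ h'] at h1
  exact (Option.some.inj h1).symm

theorem Run.BinaryAgreement.exists_complete (hBA : R.BinaryAgreement) {i : Fin N} (hi : i ∈ H)
    {t e : ℕ} {j : Fin N} (h : j ∈ (R.state t i).chosen e) :
    ∃ p ∈ H, (R.state t p).Complete (e, j) := by
  obtain ⟨p, hp, hin⟩ := (hBA e j).validity true i hi t (NodeState.mem_chosen.1 h)
  exact ⟨p, hp, (R.input_inv hp t e j).1 hin⟩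

/-- An output `0` goes back to a correct input `0`, given after `N - f` outputs `1`; Agreement
carries these to `i`. Without an output `0`, all instances are chosen. -/
theorem Run.BinaryAgreement.card_chosen (hBA : R.BinaryAgreement) {i : Fin N} (hi : i ∈ H)
    {t e : ℕ} (h : (R.state t i).AllOutput e) : N - f ≤ ((R.state t i).chosen e).card := by
  by_cases hz : ∃ j, (R.state t i).baOut e j = some false
  · obtain ⟨j, hj⟩ := hz
    obtain ⟨p, hp, hin⟩ := (hBA e j).validity false i hi t hj
    refine ((R.input_inv hp t e j).2 hin).trans (Finset.card_le_card fun k hk => ?_)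
    rw [NodeState.mem_chosen] at hk ⊢
    obtain ⟨t', ht'⟩ := (hBA e k).agreement true p hp ⟨t, hk⟩ i hi
    obtain ⟨b, hb⟩ := Option.ne_none_iff_exists'.1 (h k)
    rw [hb, Run.baOut_eq hb ht']
  · have : (R.state t i).chosen e = Finset.univ := by
      ext k
      simp only [NodeState.mem_chosen, Finset.mem_univ, iff_true]
      obtain ⟨b, hb⟩ := Option.ne_none_iff_exists'.1 (h k)
      cases b
      · exact absurd ⟨k, hb⟩ hz
      · exact hb
    rw [this, Finset.card_univ, Fintype.card_fin]
    exact Nat.sub_le _ _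

theorem Run.eventually_baOut {i : Fin N} {t e : ℕ} {j : Fin N} {b : Bool}
    (h : (R.state t i).baOut e j = some b) : ∀ᶠ t in atTop, (R.state t i).baOut e j = some b :=
  eventually_atTop.2 ⟨t, fun _ ht => (R.node_extends i ht).baOut _ _ _ h⟩

theorem Run.Fair.eventually_allOutput (hfair : R.Fair) (hBA : R.BinaryAgreement)
    (hN : 3 * f + 1 ≤ N) (hH : (Hᶜ).card ≤ f) {e : ℕ} (he : 1 ≤ e)
    (hep : ∀ i ∈ H, ∀ᶠ t in atTop, e ≤ (R.state t i).epoch) {i : Fin N} (hi : i ∈ H) :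
    ∀ᶠ t in atTop, (R.state t i).AllOutput e := by
  have hsucc : ∀ i j t, (R.state t i).baIn e j ≠ none → (R.state (t + 1) i).baIn e j ≠ none :=
    fun i j t => (R.node_extends i t.le_succ).baIn_ne_none
  -- The dispersals of correct nodes complete, so `inputOne` becomes enabled for them unless an
  -- input was given before.
  have hin : ∀ j ∈ H, ∀ i ∈ H, ∀ᶠ t in atTop, (R.state t i).baIn e j ≠ none := by
    intro j hj i hi
    have hcomp : ∀ᶠ t in atTop, (R.state t i).Complete (e, j) := by
      obtain ⟨t, ht⟩ := (hep j hj).exists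
      obtain ⟨⟨T, V⟩, hTV⟩ := Option.ne_none_iff_exists'.1 (R.exists_proposed j t e he ht)
      exact hfair.eventually_complete_of_proposes hN hH hj ⟨t, hTV⟩ hi
    refine hfair.eventually_of_enabled hi (.inputOne e j) (hsucc i j) ?_ (.of_forall ?_)
    · filter_upwards [hcomp, hep i hi] with t h1 h2
      by_cases hn : (R.state t i).baIn e j = none
      · exact Or.inr ⟨he, h2, h1, hn⟩
      · exact Or.inl hn
    · intro t _ hnext
      unfold Run.state
      rw [hnext]
      simp [Config.update, LocalAction.exec]
  have hcard : ∀ i ∈ H, ∀ᶠ t in atTop, N - f ≤ ((R.state t i).chosen e).card := by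
    intro i hi
    -- A correct input `0` presupposes `N - f` outputs `1`, which spread by Agreement. If there
    -- never is one, Validity forces the output `1` in the instances of all correct nodes, again at
    -- least `N - f`.
    by_cases hz : ∃ p ∈ H, ∃ t j, (R.state t p).baIn e j = some false
    · obtain ⟨p, hp, t, j, hj⟩ := hz
      have hall : ∀ᶠ t' in atTop, ∀ k ∈ (R.state t p).chosen e, k ∈ (R.state t' i).chosen e := by
        refine (eventually_all_finset _).2 fun k hk => ?_
        simp only [NodeState.mem_chosen] at hk ⊢
        obtain ⟨t', ht'⟩ := (hBA e k).agreement true p hp ⟨t, hk⟩ i hi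
        exact Run.eventually_baOut ht'
      filter_upwards [hall] with t' ht'
      exact ((R.input_inv hp t e j).2 hj).trans (Finset.card_le_card ht')
    · have hall : ∀ᶠ t in atTop, ∀ k ∈ H, k ∈ (R.state t i).chosen e := by
        refine (eventually_all_finset _).2 fun k hk => ?_
        obtain ⟨t, ht⟩ := (hBA e k).termination (fun p hp => (hin k hk p hp).exists) i hi
        obtain ⟨b, hb⟩ := Option.ne_none_iff_exists'.1 ht
        cases b
        · obtain ⟨p, hp, hpf⟩ := (hBA e k).validity false i hi t hb
          exact absurd ⟨p, hp, t, k, hpf⟩ hz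
        · simp only [NodeState.mem_chosen]
          exact Run.eventually_baOut hb
      filter_upwards [hall] with t ht
      refine le_trans ?_ (Finset.card_le_card ht)
      have := card_add_card_compl_fin (H := H)
      omega
  -- Now `inputZero` supplies the missing inputs, also for instances of faulty nodes, and
  -- Termination applies to all of them.
  have hin' : ∀ j, ∀ i ∈ H, ∀ᶠ t in atTop, (R.state t i).baIn e j ≠ none := by
    intro j i hi
    refine hfair.eventually_of_enabled hi (.inputZero e) (hsucc i j) ?_ (.of_forall ?_)
    · filter_upwards [hcard i hi, hep i hi] with t h1 h2
      by_cases hn : (R.state t i).baIn e j = none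
      · exact Or.inr ⟨he, h2, h1, j, hn⟩
      · exact Or.inl hn
    · intro t _ hnext
      unfold Run.state
      rw [hnext]
      simp only [Config.update, LocalAction.exec, Function.update_self]
      split_ifs with h
      · simp
      · exact h
  refine eventually_all.2 fun j => ?_
  obtain ⟨t, ht⟩ := (hBA e j).termination (fun p hp => (hin' j p hp).exists) i hi
  exact eventually_atTop.2 ⟨t, fun _ htt => (R.node_extends i htt).baOut_ne_none ht⟩

/-- The induction runs over all correct nodes at once, since the outputs of an epoch are guaranteed
only when every correct node has reached it. -/
theorem Run.Fair.eventually_epoch (hfair : R.Fair) (hBA : R.BinaryAgreement)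
    (hN : 3 * f + 1 ≤ N) (hH : (Hᶜ).card ≤ f) (e : ℕ) :
    ∀ i ∈ H, ∀ᶠ t in atTop, e ≤ (R.state t i).epoch := by
  induction e with
  | zero => simp
  | succ e ih =>
    intro i hi
    have hout : ∀ᶠ t in atTop, e = 0 ∨ (R.state t i).AllOutput e := by
      rcases Nat.eq_zero_or_pos e with h | h
      · exact .of_forall fun _ => Or.inl h
      · exact (hfair.eventually_allOutput hBA hN hH h ih hi).mono fun _ => Or.inr
    refine hfair.eventually_of_enabled hi .startEpoch
      (fun t h => h.trans (R.node_extends i t.le_succ).epoch) ?_ ?_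
    · filter_upwards [ih i hi, hout] with t h1 h2
      rcases h1.eq_or_lt with h | h
      · rw [h] at h2
        exact Or.inr h2
      · exact Or.inl h
    · filter_upwards [ih i hi] with t h1 _ hnext
      unfold Run.state
      rw [hnext]
      simpa [Config.update, LocalAction.exec] using h1

/-- The retrieval phase of an epoch is started after all outputs, for all chosen instances. -/
theorem Run.retrievalStarted_inv (R : Run P H txs) {i : Fin N} (hi : i ∈ H) (t : ℕ) :
    ∀ e ∈ (R.state t i).retrievalStarted, (R.state t i).AllOutput e ∧
      ∀ j ∈ (R.state t i).chosen e, ((R.state t i).vid (e, j)).retrieving := by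
  induction t with
  | zero => rw [R.state_zero]; simp
  | succ t ih =>
    intro e he
    have hext := R.node_extends i (Nat.le_add_right t 1)
    have hvid : ∀ v, ((R.state t i).vid v).retrieving → ((R.state (t + 1) i).vid v).retrieving :=
      fun v => (Run.vid_extends hi v t.le_succ).retrieving
    have old : e ∈ (R.state t i).retrievalStarted → (R.state (t + 1) i).AllOutput e ∧
        ∀ j ∈ (R.state (t + 1) i).chosen e, ((R.state (t + 1) i).vid (e, j)).retrieving := by
      intro he
      obtain ⟨h1, h2⟩ := ih e he
      refine ⟨h1.mono hext, fun j hj => hvid _ (h2 j ?_)⟩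
      rwa [h1.chosen_eq hext] at hj
    have hstep := R.nodeStep t i
    generalize R.state (t + 1) i = s at *
    cases hstep with
    | stay => exact old he
    | act a _ _ hen =>
      cases a with
      | startRetrieval e' =>
        rcases he with rfl | he
        · refine ⟨hen.2.2.1, fun j hj => ?_⟩
          exact Or.inr ⟨rfl, hj⟩
        · exact old he
      | _ => exact old (by simpa [LocalAction.exec, NodeState.retrieve] using he)
    | receive src v m _ _ => exact old he
    | output e j b _ => exact old he

theorem Run.Fair.eventually_retrievalStarted (hfair : R.Fair) (hBA : R.BinaryAgreement)
    (hN : 3 * f + 1 ≤ N) (hH : (Hᶜ).card ≤ f) {e : ℕ} (he : 1 ≤ e) {i : Fin N} (hi : i ∈ H) :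
    ∀ᶠ t in atTop, e ∈ (R.state t i).retrievalStarted := by
  refine hfair.eventually_of_enabled hi (.startRetrieval e)
    (fun t h => (R.node_extends i t.le_succ).retrievalStarted h) ?_ (.of_forall ?_)
  · filter_upwards [hfair.eventually_epoch hBA hN hH e i hi, hfair.eventually_allOutput hBA hN hH he
      (hfair.eventually_epoch hBA hN hH e) hi] with t h1 h2
    by_cases hs : e ∈ (R.state t i).retrievalStarted
    · exact Or.inl hs
    · exact Or.inr ⟨he, h1, h2, hs⟩
  · intro t _ hnext
    unfold Run.state
    rw [hnext]
    simp [Config.update, LocalAction.exec, NodeState.retrieve]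

/-- Validity traces the output `1` to a correct node at which the dispersal has completed, so the
retrieval of a chosen block ends even if its proposer is faulty. -/
theorem Run.Fair.eventually_chosen_result (hfair : R.Fair) (hBA : R.BinaryAgreement)
    (hN : 3 * f + 1 ≤ N) (hH : (Hᶜ).card ≤ f) {e : ℕ} (he : 1 ≤ e) {i : Fin N} (hi : i ∈ H) :
    ∀ᶠ t in atTop, ∀ j ∈ (R.state t i).chosen e, ((R.state t i).vid (e, j)).result ≠ none := by
  refine eventually_all.2 fun j => ?_
  by_cases h : ∃ t, j ∈ (R.state t i).chosen e
  · obtain ⟨t, ht⟩ := h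
    obtain ⟨p, hp, hc⟩ := hBA.exists_complete hi ht
    obtain ⟨t', ht', htt⟩ := ((hfair.eventually_retrievalStarted hBA hN hH he hi).and
      (eventually_ge_atTop t)).exists
    have hret := (R.retrievalStarted_inv hi t' e ht').2 j ((R.node_extends i htt).chosen e ht)
    exact (hfair.eventually_result hN hH hp hc hi hret).mono fun _ h _ => h
  · exact .of_forall fun t ht => absurd ⟨t, ht⟩ h

end Epochs

/-! ### Estimations, inter-node linking and the log. -/

section Delivery

variable {N f : ℕ} {Tx Chunk Digest : Type*} {P : Protocol N f Tx Chunk Digest}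
  {H : Finset (Fin N)} {txs : Fin N → ℕ → Tx} {R : Run P H txs}

/-- Two states agree on everything that concerns the delivery of blocks. -/
structure NodeState.SameDelivery (s s' : NodeState N Tx Chunk Digest) : Prop where
  finished : s'.finished = s.finished
  linking : s'.linking = s.linking
  estimation : s'.estimation = s.estimation
  delivered : s'.delivered = s.delivered
  log : s'.log = s.log

/-- A step delivers the chosen blocks of an epoch, or delivers blocks by inter-node linking, or does
not concern the delivery of blocks. -/
theorem Run.deliveryStep (R : Run P H txs) (t : ℕ) (i : Fin N) :
    (R.state t i).SameDelivery (R.state (t + 1) i) ∨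
    (LocalAction.deliverChosen.Enabled P i (R.state t i) ∧
      R.state (t + 1) i = (LocalAction.deliverChosen.exec P i (txs i) (R.state t i)).1) ∨
    (LocalAction.deliverLinked.Enabled P i (R.state t i) ∧
      R.state (t + 1) i = (LocalAction.deliverLinked.exec P i (txs i) (R.state t i)).1) := by
  have hstep := R.nodeStep t i
  generalize R.state (t + 1) i = s at hstep
  cases hstep with
  | stay => exact Or.inl ⟨rfl, rfl, rfl, rfl, rfl⟩
  | act a _ _ hen =>
    cases a with
    | deliverChosen => exact Or.inr (Or.inl ⟨hen, rfl⟩)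
    | deliverLinked => exact Or.inr (Or.inr ⟨hen, rfl⟩)
    | _ => exact Or.inl ⟨rfl, rfl, rfl, rfl, rfl⟩
  | receive src v m _ _ => exact Or.inl ⟨rfl, rfl, rfl, rfl, rfl⟩
  | output e j b _ => exact Or.inl ⟨rfl, rfl, rfl, rfl, rfl⟩

theorem mem_sortInstances {W : Set (VidId N)} (hW : W.Finite) (v : VidId N) :
    v ∈ sortInstances W hW ↔ v ∈ W := by
  simp only [sortInstances, List.mem_map, Finset.mem_sort, Finset.mem_image, Set.Finite.mem_toFinset]
  exact ⟨by rintro ⟨_, ⟨w, hw, rfl⟩, rfl⟩; exact hw, fun h => ⟨toLex v, ⟨v, h, rfl⟩, rfl⟩⟩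

theorem NodeState.downloaded_eq {s : NodeState N Tx Chunk Digest} {v : VidId N}
    (h : (s.vid v).result ≠ none) : (s.vid v).result = some (s.downloaded v) := by
  obtain ⟨x, hx⟩ := Option.ne_none_iff_exists'.1 h
  simp [NodeState.downloaded, hx]

/-- A correct node delivers the blocks of correct nodes as they were proposed. -/
theorem Run.log_inv (hN : 3 * f + 1 ≤ N) (hH : (Hᶜ).card ≤ f) (hhash : R.CollisionFree)
    {k : Fin N} (hk : k ∈ H) (t : ℕ) : ∀ d ∈ (R.state t k).log, d.proposer ∈ H →
      ∃ T V, R.Proposes d.proposer d.epoch T V ∧ d.content = .block (.formatted T V) := by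
  induction t with
  | zero => rw [R.state_zero]; simp
  | succ t ih =>
    intro d hd hdH
    rcases R.deliveryStep t k with h | ⟨hen, h⟩ | ⟨hen, h⟩
    · exact ih d (h.log ▸ hd) hdH
    · rw [h] at hd
      simp only [LocalAction.exec, NodeState.retrieve, List.mem_append, List.mem_map,
        Finset.mem_sort] at hd
      rcases hd with hd | ⟨j, hj, rfl⟩
      · exact ih d hd hdH
      · exact Run.result_eq hN hH hhash (v := (_, j)) hdH hk
          (NodeState.downloaded_eq (hen.2.2 j hj))
    · rw [h] at hd
      obtain ⟨W, hW, hfin, hres⟩ := hen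
      simp only [LocalAction.exec, hW, dif_pos hfin, List.mem_append, List.mem_map,
        mem_sortInstances] at hd
      rcases hd with hd | ⟨v, hv, rfl⟩
      · exact ih d hd hdH
      · exact Run.result_eq hN hH hhash (v := v) hdH hk (NodeState.downloaded_eq (hres v hv))

/-- Every estimation lies between observations of correct nodes for the same epoch. -/
theorem Run.estimation_bounds (hN : 3 * f + 1 ≤ N) (hH : (Hᶜ).card ≤ f)
    (hBA : R.BinaryAgreement) (hhash : R.CollisionFree) {k : Fin N} (hk : k ∈ H) (t : ℕ) :
    ∀ e E, (R.state t k).estimation e = some E → ∀ j, ∃ p ∈ H, ∃ q ∈ H, ∃ Tp Vp Tq Vq,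
      R.Proposes p e Tp Vp ∧ R.Proposes q e Tq Vq ∧ (Vp j : ℕ∞) ≤ E j ∧ E j ≤ (Vq j : ℕ∞) := by
  induction t with
  | zero => rw [R.state_zero]; simp
  | succ t ih =>
    intro e E hE j
    rcases R.deliveryStep t k with h | ⟨hen, h⟩ | ⟨hen, h⟩
    · exact ih e E (h.estimation ▸ hE) j
    · rw [h] at hE
      simp only [LocalAction.exec, NodeState.retrieve, Function.update_apply] at hE
      split_ifs at hE with he
      swap
      · exact ih e E hE j
      subst he
      obtain rfl := Option.some.inj hE
      have hout := (R.retrievalStarted_inv hk t _ hen.2.1).1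
      have hcard := hBA.card_chosen hk hout
      obtain ⟨p, hp, hpc, q, hq, hqc, h1, h2⟩ := exists_le_kthLargest_le
        (A := (R.state t k).chosen ((R.state t k).finished + 1))
        (fun p => ((R.state t k).downloaded ((R.state t k).finished + 1, p)).observation j) hH
        (by omega)
      -- The instances of `p` and `q` yield the blocks that these correct nodes proposed, so the
      -- bounding values are true observations, in particular finite.
      obtain ⟨Tp, Vp, hpp, hpV⟩ := Run.result_eq hN hH hhash (v := (_, p)) hp hk
        (NodeState.downloaded_eq (hen.2.2 p hpc))
      obtain ⟨Tq, Vq, hqp, hqV⟩ := Run.result_eq hN hH hhash (v := (_, q)) hq hk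
        (NodeState.downloaded_eq (hen.2.2 q hqc))
      refine ⟨p, hp, q, hq, Tp, Vp, Tq, Vq, hpp, hqp, ?_, ?_⟩
      · simp only [hpV] at h1; exact h1
      · simp only [hqV] at h2; exact h2
    · rw [h] at hE
      exact ih e E hE j

/-- In epoch `e` the chosen blocks have been delivered, and the blocks up to the estimation have
been marked as delivered. -/
structure NodeState.Processed (s : NodeState N Tx Chunk Digest) (e : ℕ) : Prop where
  allOutput : s.AllOutput e
  log : ∀ j ∈ s.chosen e, ∃ x, (⟨e, j, x, false⟩ : Delivery N Tx) ∈ s.log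
  estimation : ∃ E, s.estimation e = some E ∧
    ∀ v : VidId N, 1 ≤ v.1 → (v.1 : ℕ∞) ≤ E v.2 → v ∈ s.delivered

theorem NodeState.Processed.mono {s s' : NodeState N Tx Chunk Digest} {e : ℕ}
    (h : s.Processed e) (hs : s.Extends s') (he : s'.estimation e = s.estimation e) :
    s'.Processed e where
  allOutput := h.allOutput.mono hs
  log j hj := by
    rw [h.allOutput.chosen_eq hs] at hj
    exact (h.log j hj).imp fun x hx => hs.log hx
  estimation := by
    rw [he]
    exact h.estimation.imp fun E hE => ⟨hE.1, fun v h1 h2 => hs.delivered (hE.2 v h1 h2)⟩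

/-- Epoch `finished + 1` is included once `linking` is set, because `deliverChosen` already makes
the estimation and the marks. The step `deliverLinked` then only moves the counter. -/
theorem Run.processed (R : Run P H txs) {k : Fin N} (hk : k ∈ H) (t : ℕ) :
    ∀ e, 1 ≤ e → e ≤ (R.state t k).finished ∨
      e = (R.state t k).finished + 1 ∧ (R.state t k).linking ≠ none →
      (R.state t k).Processed e := by
  induction t with
  | zero => rw [R.state_zero]; simp; omega
  | succ t ih =>
    intro e he1 he
    have hext := R.node_extends k (Nat.le_add_right t 1)
    rcases R.deliveryStep t k with h | ⟨hen, h⟩ | ⟨hen, h⟩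
    · rw [h.finished, h.linking] at he
      exact (ih e he1 he).mono hext (by rw [h.estimation])
    · by_cases hef : e = (R.state t k).finished + 1
      · have hout := (R.retrievalStarted_inv hk t _ hen.2.1).1
        rw [← hef] at hout
        refine ⟨hout.mono hext, fun j hj => ?_, ?_⟩
        · rw [hout.chosen_eq hext] at hj
          refine ⟨(R.state t k).downloaded (e, j), ?_⟩
          rw [h]
          simp only [LocalAction.exec, NodeState.retrieve, List.mem_append, List.mem_map,
            Finset.mem_sort]
          exact Or.inr ⟨j, hef ▸ hj, by rw [hef]; rfl⟩
        · rw [h]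
          simp only [LocalAction.exec, NodeState.retrieve, ← hef, Function.update_self]
          refine ⟨_, rfl, fun v h1 h2 => ?_⟩
          by_cases hv : v ∈ (R.state t k).delivered ∪
              {v | v.1 = e ∧ v.2 ∈ (R.state t k).chosen e}
          · exact Or.inl hv
          · exact Or.inr ⟨h1, h2, hv⟩
      · refine (ih e he1 (Or.inl ?_)).mono hext ?_
        · rw [h] at he
          simp only [LocalAction.exec, NodeState.retrieve] at he
          omega
        · rw [h]
          simp only [LocalAction.exec, NodeState.retrieve, Function.update_of_ne hef]
    · refine (ih e he1 ?_).mono hext (by rw [h]; rfl)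
      obtain ⟨W, hW, _⟩ := hen
      rw [h] at he
      simp only [LocalAction.exec, ne_eq, not_true_eq_false, and_false, or_false] at he
      rcases Nat.lt_or_ge (R.state t k).finished e with h' | h'
      · exact Or.inr ⟨by omega, by simp [hW]⟩
      · exact Or.inl h'

/-- The instances that are retrieved for inter-node linking. -/
theorem Run.linking_inv (R : Run P H txs) {k : Fin N} (hk : k ∈ H) (t : ℕ) :
    ∀ W, (R.state t k).linking = some W → (∀ v ∈ W, ((R.state t k).vid v).retrieving) ∧
      ∃ E, (R.state t k).estimation ((R.state t k).finished + 1) = some E ∧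
        ∀ v ∈ W, 1 ≤ v.1 ∧ (v.1 : ℕ∞) ≤ E v.2 := by
  induction t with
  | zero => rw [R.state_zero]; simp
  | succ t ih =>
    intro W hW
    rcases R.deliveryStep t k with h | ⟨hen, h⟩ | ⟨hen, h⟩
    · rw [h.linking] at hW
      rw [h.finished, h.estimation]
      exact ⟨fun v hv => (Run.vid_extends hk v t.le_succ).retrieving ((ih W hW).1 v hv),
        (ih W hW).2⟩
    · rw [h] at hW ⊢
      simp only [LocalAction.exec, NodeState.retrieve, Option.some.injEq] at hW ⊢
      subst hW
      exact ⟨fun v hv => Or.inr hv, _, Function.update_self .., fun v hv => ⟨hv.1, hv.2.1⟩⟩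
    · rw [h] at hW
      simp [LocalAction.exec] at hW

/-- What is marked as delivered was chosen, or is being retrieved for inter-node linking, or was
delivered by inter-node linking. -/
theorem Run.delivered_inv (R : Run P H txs) (k : Fin N) (t : ℕ) :
    ∀ v ∈ (R.state t k).delivered, (R.state t k).baOut v.1 v.2 = some true ∨
      (∃ W, (R.state t k).linking = some W ∧ v ∈ W) ∨
      ∃ x, (⟨v.1, v.2, x, true⟩ : Delivery N Tx) ∈ (R.state t k).log := by
  induction t with
  | zero => rw [R.state_zero]; simp
  | succ t ih =>
    intro v hv
    have hext := R.node_extends k (Nat.le_add_right t 1)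
    rcases R.deliveryStep t k with h | ⟨hen, h⟩ | ⟨hen, h⟩
    · rw [h.delivered] at hv
      rw [h.linking, h.log]
      exact (ih v hv).imp_left (hext.baOut _ _ _)
    · have hv' := hv
      rw [h] at hv'
      simp only [LocalAction.exec, NodeState.retrieve] at hv'
      rcases hv' with (hv' | hv') | hv'
      · rcases ih v hv' with h1 | ⟨W, hW, _⟩ | ⟨x, hx⟩
        · exact Or.inl (hext.baOut _ _ _ h1)
        · rw [hen.1] at hW; cases hW
        · exact Or.inr (Or.inr ⟨x, hext.log hx⟩)
      · refine Or.inl (hext.baOut _ _ _ ?_)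
        rw [← NodeState.mem_chosen, hv'.1]
        exact hv'.2
      · refine Or.inr (Or.inl ⟨_, ?_, hv'⟩)
        rw [h]
        rfl
    · rw [h] at hv
      obtain ⟨W, hW, hfin, _⟩ := hen
      rcases ih v hv with h1 | ⟨W', hW', hvW⟩ | ⟨x, hx⟩
      · exact Or.inl (hext.baOut _ _ _ h1)
      · rw [hW] at hW'
        cases hW'
        refine Or.inr (Or.inr ⟨(R.state t k).downloaded v, ?_⟩)
        rw [h]
        simp only [LocalAction.exec, hW, dif_pos hfin, List.mem_append, List.mem_map,
          mem_sortInstances]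
        exact Or.inr ⟨v, hvW, rfl⟩
      · exact Or.inr (Or.inr ⟨x, hext.log hx⟩)

theorem finite_setOf_le {E : Fin N → ℕ∞} {W : Set (VidId N)} (hE : ∀ j, ∃ n : ℕ, E j ≤ n)
    (hW : ∀ v ∈ W, (v.1 : ℕ∞) ≤ E v.2) : W.Finite := by
  choose n hn using hE
  refine ((Set.finite_Iic (Finset.univ.sup n)).prod Set.finite_univ).subset fun v hv => ?_
  have h1 : (v.1 : ℕ∞) ≤ n v.2 := (hW v hv).trans (hn v.2)
  exact ⟨(Nat.cast_le.1 h1).trans (Finset.le_sup (Finset.mem_univ v.2)), trivial⟩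

/-- Every correct node finishes all epochs. -/
theorem Run.Fair.exists_finished (hfair : R.Fair) (hBA : R.BinaryAgreement)
    (hhash : R.CollisionFree) (hN : 3 * f + 1 ≤ N) (hH : (Hᶜ).card ≤ f) {k : Fin N} (hk : k ∈ H)
    (m : ℕ) : ∃ t, (R.state t k).finished = m ∧ (R.state t k).linking = none := by
  induction m with
  | zero => exact ⟨0, by rw [R.state_zero]; simp⟩
  | succ m ih =>
    obtain ⟨t₁, W, hf1, hW⟩ : ∃ t W, (R.state t k).finished = m ∧
        (R.state t k).linking = some W := by
      by_contra! hno
      obtain ⟨t₀, ht₀⟩ := ih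
      have hst : ∀ᶠ t in atTop, (R.state t k).finished = m ∧ (R.state t k).linking = none := by
        refine eventually_of_succ (fun t ht => ?_) ht₀
        rcases R.deliveryStep t k with h | ⟨hen, h⟩ | ⟨⟨W, hW, _⟩, h⟩
        · rw [h.finished, h.linking]; exact ht
        · exact absurd (by rw [h]; rfl) (hno (t + 1) _ (by rw [h]; exact ht.1))
        · rw [ht.2] at hW; cases hW
      -- With the purpose `False`, fairness becomes a refutation: the step stays enabled from some
      -- time on, so it is taken, but its outcome is excluded by `hno`.
      obtain ⟨_, h⟩ := (hfair.eventually_of_enabled hk .deliverChosen (q := fun _ => False)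
        (fun _ h => h) (by
          filter_upwards [hst, hfair.eventually_retrievalStarted hBA hN hH m.succ_pos hk,
            hfair.eventually_chosen_result hBA hN hH m.succ_pos hk] with t h1 h2 h3
          right
          refine ⟨h1.2, ?_, ?_⟩
          · rw [h1.1]; exact h2
          · rw [h1.1]; exact h3) (by
          filter_upwards [hst] with t h1 _ hnext
          have hs : R.state (t + 1) k =
              (LocalAction.deliverChosen.exec P k (txs k) (R.state t k)).1 := by
            unfold Run.state
            rw [hnext]
            simp [Config.update]
          exact absurd (by rw [hs]; rfl) (hno (t + 1) _ (by rw [hs]; exact h1.1)))).exists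
      exact h
    by_contra! hno
    have hst : ∀ᶠ t in atTop, (R.state t k).finished = m ∧ (R.state t k).linking = some W := by
      refine eventually_of_succ (fun t ht => ?_) ⟨hf1, hW⟩
      rcases R.deliveryStep t k with h | ⟨hen, h⟩ | ⟨_, h⟩
      · rw [h.finished, h.linking]; exact ht
      · have h1 := hen.1
        rw [ht.2] at h1; cases h1
      · refine absurd ?_ (hno (t + 1) ?_)
        · rw [h]; rfl
        · rw [h, ← ht.1]; rfl
    obtain ⟨hret, E, hE, hWE⟩ := R.linking_inv hk t₁ W hW
    have hbounds := Run.estimation_bounds hN hH hBA hhash hk t₁ _ E hE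
    -- Correct observations bound the estimation from above, so faulty entries `⊤` cannot make the
    -- set to be linked infinite.
    have hfin : W.Finite := finite_setOf_le
      (fun j => by obtain ⟨_, _, _, _, _, _, _, Vq, _, _, _, h⟩ := hbounds j; exact ⟨Vq j, h⟩)
      fun v hv => (hWE v hv).2
    have hres : ∀ᶠ t in atTop, ∀ v ∈ W, ((R.state t k).vid v).result ≠ none := by
      refine (eventually_all_finite hfin).2 fun v hv => ?_
      -- The correct node `q` has seen `v` complete, which makes the retrieval of `v` end, whoever
      -- owns it.
      obtain ⟨_, _, q, hq, _, _, Tq, Vq, _, ⟨t', ht'⟩, _, h⟩ := hbounds v.2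
      exact hfair.eventually_result hN hH hq (R.complete_of_le_proposed hq t' _ Tq Vq ht' v.2 v.1
        (hWE v hv).1 (Nat.cast_le.1 ((hWE v hv).2.trans h))) hk (hret v hv)
    obtain ⟨_, h⟩ := (hfair.eventually_of_enabled hk .deliverLinked (q := fun _ => False)
      (fun _ h => h) (by
        filter_upwards [hst, hres] with t h1 h2
        exact Or.inr ⟨W, h1.2, hfin, h2⟩) (by
        filter_upwards [hst] with t h1 _ hnext
        refine hno (t + 1) ?_ ?_
        · unfold Run.state
          rw [hnext]
          simpa [Config.update, LocalAction.exec] using h1.1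
        · unfold Run.state
          rw [hnext]
          simp [Config.update, LocalAction.exec])).exists
    exact h

/-- In some epoch every correct node has observed the completion of a correct node's
dispersals. -/
theorem Run.Fair.exists_observed (hfair : R.Fair) (hBA : R.BinaryAgreement)
    (hN : 3 * f + 1 ≤ N) (hH : (Hᶜ).card ≤ f) {i : Fin N} (hi : i ∈ H) (n : ℕ) :
    ∃ e, 1 ≤ e ∧ ∀ p ∈ H, ∀ T V, R.Proposes p e T V → n ≤ V i := by
  have hcomp : ∀ᶠ t in atTop, ∀ p ∈ H, ∀ d ∈ Finset.Icc 1 n, (R.state t p).Complete (d, i) := by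
    refine (eventually_all_finset H).2 fun p hp => (eventually_all_finset _).2 fun d hd => ?_
    rw [Finset.mem_Icc] at hd
    obtain ⟨t, ht⟩ := (hfair.eventually_epoch hBA hN hH d i hi).exists
    obtain ⟨⟨T, V⟩, hTV⟩ := Option.ne_none_iff_exists'.1 (R.exists_proposed i t d hd.1 ht)
    exact hfair.eventually_complete_of_proposes hN hH hi ⟨t, hTV⟩ hp
  obtain ⟨t, ht⟩ := hcomp.exists
  -- An epoch that no node has started by time `t`: every proposal for it is made after the
  -- completions.
  refine ⟨Finset.univ.sup (fun p => (R.state t p).epoch) + 1, by omega, fun p hp T V hTV => ?_⟩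
  refine R.le_observation hp (t := t) (fun d h1 hd => ht p hp d (Finset.mem_Icc.2 ⟨h1, hd⟩))
    (Nat.lt_succ_of_le ?_) hTV
  exact Finset.le_sup (f := fun p => (R.state t p).epoch) (Finset.mem_univ p)

theorem Run.Proposes.one_le {i : Fin N} {e : ℕ} {T : Tx} {V : Fin N → ℕ}
    (h : R.Proposes i e T V) : 1 ≤ e := by
  obtain ⟨t, ht⟩ := h
  by_contra h0
  have := R.proposed_eq_none i t e (Or.inl (by omega))
  unfold Run.state at this
  rw [this] at ht
  cases ht

end Delivery
end DispersedLedger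

/-! ### Assembly of the theorem. -/

open DispersedLedger in
theorem mainTheorem2 {N f : ℕ} {Tx Chunk Digest : Type*} (hN : 3 * f + 1 ≤ N)
    (P : Protocol N f Tx Chunk Digest) (H : Finset (Fin N)) (hH : (Hᶜ).card ≤ f)
    (txs : Fin N → ℕ → Tx) (R : Run P H txs) (hfair : R.Fair) (hBA : R.BinaryAgreement)
    (hhash : R.CollisionFree) :
    (∀ i ∈ H, ∀ (e : ℕ) (T : Tx) (V : Fin N → ℕ), R.Proposes i e T V →
      ∀ k ∈ H,
        (∃ t linked, ⟨e, i, .block (.formatted T V), linked⟩ ∈ ((R.config t).node k).log) ∧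
        ((∃ t, ((R.config t).node k).baOut e i = some false) →
          ∃ t, ⟨e, i, .block (.formatted T V), true⟩ ∈ ((R.config t).node k).log)) ∧
    (∀ k ∈ H, ∀ (e t : ℕ) (E : Fin N → ℕ∞), ((R.config t).node k).estimation e = some E →
      ∀ j, ∃ p ∈ H, ∃ q ∈ H, ∃ Tp Vp Tq Vq, R.Proposes p e Tp Vp ∧ R.Proposes q e Tq Vq ∧
        (Vp j : ℕ∞) ≤ E j ∧ E j ≤ (Vq j : ℕ∞)) := by
  refine ⟨fun i hi e T V hp k hk => ?_,
    fun k hk e t E hE => Run.estimation_bounds hN hH hBA hhash hk t e E hE⟩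
  obtain ⟨e', he', hobs⟩ := hfair.exists_observed hBA hN hH hi e
  -- Epoch `e` must be finished for delivery as a chosen block, and `e'` for delivery by linking.
  -- With no linking in progress at `t`, a marked block is no longer pending.
  obtain ⟨t, hfin, hlink⟩ := hfair.exists_finished hBA hhash hN hH hk (max e e')
  have content : ∀ {x l}, (⟨e, i, x, l⟩ : Delivery N Tx) ∈ (R.state t k).log →
      (⟨e, i, .block (.formatted T V), l⟩ : Delivery N Tx) ∈ (R.state t k).log := by
    intro x l hx
    obtain ⟨T', V', hp', rfl⟩ := Run.log_inv hN hH hhash hk t _ hx hi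
    obtain ⟨rfl, rfl⟩ := hp.unique hp'
    exact hx
  have hproc := R.processed hk t e hp.one_le (Or.inl (by omega))
  obtain ⟨E, hE, hdel⟩ := (R.processed hk t e' he' (Or.inl (by omega))).estimation
  obtain ⟨p, hpH, _, _, Tp, Vp, _, _, hpp, _, hle, _⟩ :=
    Run.estimation_bounds hN hH hBA hhash hk t e' E hE i
  -- The lower bound at work: `e ≤ Vp i ≤ E i` for a correct `p`.
  have hmem : (e, i) ∈ (R.state t k).delivered :=
    hdel (e, i) hp.one_le ((Nat.cast_le.2 (hobs p hpH Tp Vp hpp)).trans hle)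
  have hlinked : (R.state t k).baOut e i ≠ some true →
      (⟨e, i, .block (.formatted T V), true⟩ : Delivery N Tx) ∈ (R.state t k).log := by
    intro hb
    rcases R.delivered_inv k t _ hmem with h | ⟨W, hW, _⟩ | ⟨x, hx⟩
    · exact absurd h hb
    · rw [hlink] at hW; cases hW
    · exact content hx
  constructor
  · by_cases hb : (R.state t k).baOut e i = some true
    · obtain ⟨x, hx⟩ := hproc.log i (NodeState.mem_chosen.2 hb)
      exact ⟨t, false, content hx⟩
    · exact ⟨t, true, hlinked hb⟩
  · rintro ⟨t', ht'⟩
    refine ⟨t, hlinked fun hb => ?_⟩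
    cases Run.baOut_eq hb ht'
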